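/- Let $n\ge 1$. For a pseudo-Riemannian metric $g$ (smooth, of any signature, with Levi-Civita connection $\nabla$) on an $n$-dimensional smooth manifold, a smooth $(1,1)$-tensor field $L$ is called compatible with $g$ if it is $g$-selfadjoint, nondegenerate at every point, and satisfies $$\nabla_u L=\tfrac12\bigl(u\otimes d\,\mathrm{tr}\,L+(u\otimes d\,\mathrm{tr}\,L)^*\bigr)$$ at every point and for every tangent vector $u$, where $*$ denotes the $g$-adjoint. For a smooth function $\lambda=\lambda(x_n)$ of one variable, with derivative $\lambda'$, put $$a_k=k\,\lambda'(x_n)\,x_k\quad(1\le k\le n-2),\qquad a_{n-1}=1+(n-1)\,\lambda'(x_n)\,x_{n-1},$$ and let $G_\lambda$ be the symmetric matrix and $A_\lambda$ the matrix $$G_\lambda=\begin{pmatrix} & & & & a_{n-1}\\ & & & 1 & a_{n-2}\\ & & \cdot^{\,\cdot^{\,\cdot}} & & \vdots\\ & 1 & & & a_1\\ a_{n-1} & a_{n-2} & \cdots & a_1 & \sum_{i=1}^{n-2}a_ia_{n-i-1}\end{pmatrix},\qquad A_\lambda=\begin{pmatrix}\lambda(x_n) & 1 & & & a_1\\ & \lambda(x_n)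 & \ddots & & a_2\\ & & \ddots & 1 & \vdots\\ & & & \lambda(x_n) & a_{n-1}\\ & & & & \lambda(x_n)\end{pmatrix}$$ (blank entries are $0$; for $n=1$ these are $G_\lambda=(1)$, $A_\lambda=(\lambda(x_1))$). 1. Let $L$ be compatible with $g$ on a smooth $n$-manifold $M$ and suppose that, at every point of a neighbourhood of $p\in M$, $L$ is conjugate to a single $n\times n$ Jordan block with a real eigenvalue $\lambda$ (a function of the point). Then there exist a local coordinate system $x_1,\dots,x_n$ around $p$ and a sign $\varepsilon\in\{1,-1\}$ such that $\lambda=\lambda(x_n)$ is a smooth function of $x_n$ only and, in these coordinates, $g=\varepsilon\,G_\lambda$ and $L=A_\lambda$. 2. Conversely, let $\lambda=\lambda(x_n)$ be an arbitrary smooth function on an open set $I\subseteq\mathbb R$ with $\lambda(x_n)\neq0$ for all $x_n\in I$, and let $\varepsilon\in\{1,-1\}$. Then $g=\varepsilon\,G_\lambda$ is nondegenerate exactly where $1+(n-1)\lambda'(x_n)x_{n-1}\ne0$ (for $n=1$, everywhere), and on the domain $\{x\in\mathbb R^n : x_n\in I,\ \det G_\lambda(x)\neq 0\}$ it is a pseudo-Riemannian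 metric with which $L=A_\lambda$ is compatible. -/

import Mathlib

open scoped Manifold ContDiff Topology Matrix

noncomputable section

namespace JordanNormalForm

/-- Coordinate space `ℝⁿ`. -/
abbrev E (n : ℕ) : Type := EuclideanSpace ℝ (Fin n)

/-! ### Tensor calculus on open subsets of `ℝⁿ`

A metric is given by the matrix `G x = (g_{ij}(x))`, a `(1,1)`-tensor by the matrix
`A x = (L^i_j(x))` (row index `i`, column index `j`). -/

/-- The partial derivative `∂f/∂x_k` (indices start at `0` here). -/
def pderiv {n : ℕ} (f : E n → ℝ) (k : Fin n) (x : E n) : ℝ :=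
  fderiv ℝ f x (EuclideanSpace.single k 1)

/-- The Christoffel symbols of the Levi-Civita connection,
`Γ^i_{kj} = ½ ∑_l g^{il} (∂_k g_{lj} + ∂_j g_{lk} - ∂_l g_{kj})`. -/
def christoffel {n : ℕ} (G : E n → Matrix (Fin n) (Fin n) ℝ) (x : E n) (i k j : Fin n) : ℝ :=
  (1 / 2) * ∑ l, (G x)⁻¹ i l *
    (pderiv (fun y => G y l j) k x + pderiv (fun y => G y l k) j x
      - pderiv (fun y => G y k j) l x)

/-- The matrix of the covariant derivative `∇_u L` at `x`:
`(∇_u L)^i_j = ∑_k u^k (∂_k L^i_j + ∑_l Γ^i_{kl} L^l_j - ∑_l Γ^l_{kj} L^i_l)`. -/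
def covDeriv {n : ℕ} (G A : E n → Matrix (Fin n) (Fin n) ℝ) (x : E n) (u : Fin n → ℝ) :
    Matrix (Fin n) (Fin n) ℝ :=
  Matrix.of fun i j => ∑ k, u k *
    (pderiv (fun y => A y i j) k x
      + ∑ l, christoffel G x i k l * A x l j
      - ∑ l, christoffel G x l k j * A x i l)

/-- The matrix of the endomorphism `u ⊗ d tr L : v ↦ d(tr L)(v) u`. -/
def tensorDTrace {n : ℕ} (A : E n → Matrix (Fin n) (Fin n) ℝ) (x : E n) (u : Fin n → ℝ) :
    Matrix (Fin n) (Fin n) ℝ :=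
  Matrix.of fun i j => u i * pderiv (fun y => (A y).trace) j x

/-- The matrix of the adjoint `B*` of an endomorphism with respect to the nondegenerate symmetric
form with matrix `S`, i.e. `S(B* v, w) = S(v, B w)`. -/
def adjointWrt {n : ℕ} (S B : Matrix (Fin n) (Fin n) ℝ) : Matrix (Fin n) (Fin n) ℝ :=
  S⁻¹ * Bᵀ * S

/-- `G` is a smooth pseudo-Riemannian metric (of any signature) on the open set `U ⊆ ℝⁿ`. -/
structure IsMetricOn {n : ℕ} (U : Set (E n)) (G : E n → Matrix (Fin n) (Fin n) ℝ) : Prop where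
  smooth : ∀ i j, ContDiffOn ℝ ∞ (fun x => G x i j) U
  symm : ∀ x ∈ U, (G x).IsSymm
  nondegenerate : ∀ x ∈ U, (G x).det ≠ 0

/-- The smooth `(1,1)`-tensor `A` is compatible with the metric `G` on the open set `U ⊆ ℝⁿ`: it is
`G`-selfadjoint, nondegenerate, and `∇_u L = ½ (u ⊗ d tr L + (u ⊗ d tr L)*)` for all tangent
vectors `u` at all points of `U`. -/
structure IsCompatibleOn {n : ℕ} (U : Set (E n)) (G A : E n → Matrix (Fin n) (Fin n) ℝ) :
    Prop where
  smooth : ∀ i j, ContDiffOn ℝ ∞ (fun x => A x i j) U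
  selfadjoint : ∀ x ∈ U, (A x)ᵀ * G x = G x * A x
  nondegenerate : ∀ x ∈ U, (A x).det ≠ 0
  covDeriv_eq : ∀ x ∈ U, ∀ u : Fin n → ℝ,
    covDeriv G A x u =
      (1 / 2 : ℝ) • (tensorDTrace A x u + adjointWrt (G x) (tensorDTrace A x u))

/-! ### Tensor fields on a manifold and their components in a chart -/

section Manifold

variable {n : ℕ} (M : Type*) [TopologicalSpace M] [ChartedSpace (E n) M]

/-- A field of bilinear forms on the tangent spaces of `M`. -/
abbrev BilinField : Type _ :=
  ∀ p : M, TangentSpace (𝓡 n) p →ₗ[ℝ] TangentSpace (𝓡 n) p →ₗ[ℝ] ℝ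

/-- A field of endomorphisms of the tangent spaces of `M`, i.e. a `(1,1)`-tensor field. -/
abbrev EndField : Type _ :=
  ∀ p : M, TangentSpace (𝓡 n) p →ₗ[ℝ] TangentSpace (𝓡 n) p

variable {M}

/-- The coordinate vector `∂/∂x_i` of the chart `φ` at the point with coordinates `y`. -/
def coordVec (φ : OpenPartialHomeomorph M (E n)) (y : E n) (i : Fin n) :
    TangentSpace (𝓡 n) (φ.symm y) :=
  mfderiv (𝓡 n) (𝓡 n) φ.symm y (EuclideanSpace.single i (1 : ℝ) : E n)

/-- The components `g_{ij} = g(∂/∂x_i, ∂/∂x_j)` in the chart `φ`, as functions of the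
coordinates. -/
def bilinComponents (φ : OpenPartialHomeomorph M (E n)) (g : BilinField (n := n) M) (y : E n) :
    Matrix (Fin n) (Fin n) ℝ :=
  Matrix.of fun i j => g (φ.symm y) (coordVec φ y i) (coordVec φ y j)

/-- The components `L^i_j = dx_i(L(∂/∂x_j))` in the chart `φ`, as functions of the coordinates. -/
def endComponents (φ : OpenPartialHomeomorph M (E n)) (L : EndField (n := n) M) (y : E n) :
    Matrix (Fin n) (Fin n) ℝ :=
  Matrix.of fun i j =>
    let w : E n := mfderiv (𝓡 n) (𝓡 n) φ (φ.symm y) (L (φ.symm y) (coordVec φ y j))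
    w i

/-- `g` is a smooth pseudo-Riemannian metric on `M`. The conditions are tensorial, so it does not
matter which charts of the smooth structure are used to express them; the same holds for
`IsCompatible`. -/
def IsMetric (g : BilinField (n := n) M) : Prop :=
  ∀ φ ∈ atlas (E n) M, IsMetricOn φ.target (bilinComponents φ g)

/-- The `(1,1)`-tensor field `L` is compatible with the metric `g` on `M`. -/
def IsCompatible (g : BilinField (n := n) M) (L : EndField (n := n) M) : Prop :=
  ∀ φ ∈ atlas (E n) M,
    IsCompatibleOn φ.target (bilinComponents φ g) (endComponents φ L)

end Manifold

/-! ### Jordan blocks and the normal form -/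

/-- The `n × n` Jordan block with eigenvalue `c` (ones above the diagonal). -/
def jordanBlock (n : ℕ) (c : ℝ) : Matrix (Fin n) (Fin n) ℝ :=
  Matrix.of fun i j => if i = j then c else if j.val = i.val + 1 then 1 else 0

/-- In a suitable basis, the endomorphism `T` is the single real Jordan block of full size with
eigenvalue `c`. -/
def IsSingleJordanBlock (n : ℕ) {V : Type*} [AddCommGroup V] [Module ℝ V] (T : V →ₗ[ℝ] V)
    (c : ℝ) : Prop :=
  ∃ b : Module.Basis (Fin n) ℝ V, LinearMap.toMatrix b b T = jordanBlock n c

/-- The coordinate `x_k`, numbered `x_1, …, x_n` (and `0` for `k` outside this range). -/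
def coord {n : ℕ} (x : E n) (k : ℕ) : ℝ :=
  if h : 1 ≤ k ∧ k ≤ n then x ⟨k - 1, by omega⟩ else 0

/-- `a_k = k λ'(x_n) x_k` for `k < n - 1`, and `a_{n-1} = 1 + (n-1) λ'(x_n) x_{n-1}`. -/
def aCoeff {n : ℕ} (lam : ℝ → ℝ) (x : E n) (k : ℕ) : ℝ :=
  (if k + 1 = n then 1 else 0) + (k : ℝ) * deriv lam (coord x n) * coord x k

/-- The normal form of the metric. With rows `r` and columns `c` numbered from `1` to `n`: ones on
the antidiagonal `r + c = n + 1` inside the block `r, c < n`, the last column and the last row equal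
to `a_{n-1}, …, a_1, ∑_{i=1}^{n-2} a_i a_{n-i-1}`. For `n = 1` it is the metric `dx_1²`. -/
def gNormal {n : ℕ} (lam : ℝ → ℝ) (x : E n) : Matrix (Fin n) (Fin n) ℝ :=
  Matrix.of fun i j =>
    let r := i.val + 1
    let c := j.val + 1
    if r < n then
      if c < n then (if r + c = n + 1 then 1 else 0)
      else aCoeff lam x (n - r)
    else
      if c < n then aCoeff lam x (n - c)
      else if n = 1 then 1
      else ∑ k ∈ Finset.Icc 1 (n - 2), aCoeff lam x k * aCoeff lam x (n - k - 1)

/-- The normal form of `L`. With rows `r` and columns `c` numbered from `1` to `n`: `λ(x_n)` on the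
diagonal, the last column equal to `a_1, …, a_{n-1}, λ(x_n)`, and ones above the diagonal in the
other columns. -/
def lNormal {n : ℕ} (lam : ℝ → ℝ) (x : E n) : Matrix (Fin n) (Fin n) ℝ :=
  Matrix.of fun i j =>
    let r := i.val + 1
    let c := j.val + 1
    if r = c then lam (coord x n)
    else if c = n then aCoeff lam x r
    else if c = r + 1 then 1
    else 0

end JordanNormalForm

end

/-! Indices start at `0`. Write `S` for the nilpotent Jordan block and `R` for the antidiagonal
matrix `reversal n`. Both directions go through a coframe `θ^0, …, θ^{n-1}`, the rows of a matrix
`K`, with `g = ε Kᵀ R K` and `K L = (λ + S) K`.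

Such a coframe exists near `p`. The nilpotent field `N = L - λ` is selfadjoint with `N^{n-1} ≠ 0`,
so some vector has `g(v, N^{n-1} v) ≠ 0`. Rescaling `v` and adding multiples of `N^a v` makes `g(v,
N^j v)` equal to `ε` for `j = n - 1` and `0` otherwise, smoothly in the point; the frame consists of
the vectors `N^{n-1-i} v` (`exists_normalized_vector`, `exists_canonical_coframe`).

In this coframe the connection form `W` is skew for `R`, and compatibility becomes an equation for
`[W, S] + dλ`. Its trace against `S` forces `dλ = μ θ^{n-1}`. The equation then determines `W`: two
solutions differ by a matrix that commutes with `S`, hence is a polynomial in `S` and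
`R`-selfadjoint, while it is also skew, hence zero. The solution is the explicit `frameConnection`,
and vanishing torsion turns into the structure equations `dθ^m = -m dλ ∧ θ^{m-1}`
(`coframe_structure`).

These integrate one after another. If `dX_{m-1} = θ^{m-1} - (m-1) X_{m-2} dλ`, then `θ^m - m X_{m-1}
dλ` is closed, and the Poincaré lemma on a ball gives `X_m`. With the `X_m` as coordinates, `dλ` is
proportional to `dX_{n-1}`, so `λ` depends on the last coordinate only, and `θ^m = dX_m + m X_{m-1}
dλ` becomes `normalCoframe`. Expanding `ε Kᵀ R K` and `K⁻¹ (λ + S) K` for it yields `G_λ` and `A_λ`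
(`exists_normal_coordinates`, `gNormal_eq`, `normalCoframe_mul_lNormal`).

The converse runs the same computation backwards. The normal coframe satisfies the structure
equations for any `λ`, so `frameConnection` is torsion-free as well as metric; by uniqueness it is
the Levi-Civita connection, and its bracket with `S` is the compatibility equation
(`covDeriv_eq_of_coframe_structure`). The result is carried to a manifold by the transformation
rules for components. -/

noncomputable section

namespace JordanNormalForm

/-! ### Matrix calculus in coordinates and the Levi-Civita connection. -/

section Calculus

variable {n : ℕ}

/-- All entries of a matrix-valued function are differentiable at `x`. -/
def EntriesDifferentiableAt (A : E n → Matrix (Fin n) (Fin n) ℝ) (x : E n) : Prop :=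
  ∀ i j, DifferentiableAt ℝ (fun y => A y i j) x

/-- The entrywise partial derivative of a matrix-valued function. -/
def matrixPderiv (A : E n → Matrix (Fin n) (Fin n) ℝ) (k : Fin n) (x : E n) :
    Matrix (Fin n) (Fin n) ℝ :=
  Matrix.of fun i j => pderiv (fun y => A y i j) k x

theorem pderiv_congr {f h : E n → ℝ} {x : E n} (hfh : f =ᶠ[𝓝 x] h) (k : Fin n) :
    pderiv f k x = pderiv h k x := by
  simp [pderiv, hfh.fderiv_eq]

theorem pderiv_add {f h : E n → ℝ} {x : E n} (hf : DifferentiableAt ℝ f x)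
    (hh : DifferentiableAt ℝ h x) (k : Fin n) :
    pderiv (fun y => f y + h y) k x = pderiv f k x + pderiv h k x := by
  simp [pderiv, fderiv_fun_add hf hh]

theorem pderiv_mul {f h : E n → ℝ} {x : E n} (hf : DifferentiableAt ℝ f x)
    (hh : DifferentiableAt ℝ h x) (k : Fin n) :
    pderiv (fun y => f y * h y) k x = pderiv f k x * h x + f x * pderiv h k x := by
  simp [pderiv, fderiv_fun_mul hf hh]
  ring

theorem pderiv_const_mul {f : E n → ℝ} {x : E n} (c : ℝ) (hf : DifferentiableAt ℝ f x)
    (k : Fin n) : pderiv (fun y => c * f y) k x = c * pderiv f k x := by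
  simp [pderiv, fderiv_const_mul hf]

theorem pderiv_const (c : ℝ) (k : Fin n) (x : E n) : pderiv (fun _ => c) k x = 0 := by
  simp [pderiv]

theorem pderiv_sum {ι : Type*} {s : Finset ι} {f : ι → E n → ℝ} {x : E n}
    (hf : ∀ i ∈ s, DifferentiableAt ℝ (f i) x) (k : Fin n) :
    pderiv (fun y => ∑ i ∈ s, f i y) k x = ∑ i ∈ s, pderiv (f i) k x := by
  simp [pderiv, fderiv_fun_sum hf]

/-- The chain rule for a function of one variable. -/
theorem pderiv_comp {f : E n → ℝ} {h : ℝ → ℝ} {x : E n} (hh : DifferentiableAt ℝ h (f x))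
    (hf : DifferentiableAt ℝ f x) (k : Fin n) :
    pderiv (fun y => h (f y)) k x = deriv h (f x) * pderiv f k x := by
  have := (hh.hasDerivAt.comp_hasFDerivAt x hf.hasFDerivAt).fderiv
  simp only [Function.comp_def] at this
  simp [pderiv, this]

theorem pderiv_apply (i k : Fin n) (x : E n) :
    pderiv (fun y => y i) k x = if i = k then 1 else 0 := by
  have : HasFDerivAt (fun y : E n => y i) (EuclideanSpace.proj i : E n →L[ℝ] ℝ) x :=
    (EuclideanSpace.proj i : E n →L[ℝ] ℝ).hasFDerivAt
  simp [pderiv, this.fderiv]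

/-- A derivative is determined by the partial derivatives. -/
theorem fderiv_eq_sum_pderiv (f : E n → ℝ) (x u : E n) :
    fderiv ℝ f x u = ∑ k, u k * pderiv f k x := by
  have hu : u = ∑ k, u k • EuclideanSpace.single k (1 : ℝ) := by
    ext i
    simp [Pi.single_apply]
  conv_lhs => rw [hu]
  simp [pderiv]

theorem EntriesDifferentiableAt.mul {A B : E n → Matrix (Fin n) (Fin n) ℝ} {x : E n}
    (hA : EntriesDifferentiableAt A x) (hB : EntriesDifferentiableAt B x) :
    EntriesDifferentiableAt (fun y => A y * B y) x := fun i j => by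
  simp only [Matrix.mul_apply]
  exact DifferentiableAt.fun_sum fun l _ => (hA i l).mul (hB l j)

theorem EntriesDifferentiableAt.transpose {A : E n → Matrix (Fin n) (Fin n) ℝ} {x : E n}
    (hA : EntriesDifferentiableAt A x) : EntriesDifferentiableAt (fun y => (A y)ᵀ) x :=
  fun i j => hA j i

theorem entriesDifferentiableAt_const (A : Matrix (Fin n) (Fin n) ℝ) (x : E n) :
    EntriesDifferentiableAt (fun _ => A) x := fun _ _ => differentiableAt_const _

theorem matrixPderiv_congr {A B : E n → Matrix (Fin n) (Fin n) ℝ} {x : E n}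
    (h : A =ᶠ[𝓝 x] B) (k : Fin n) : matrixPderiv A k x = matrixPderiv B k x := by
  ext i j
  exact pderiv_congr (h.mono fun y hy => by simp [hy]) k

theorem matrixPderiv_mul {A B : E n → Matrix (Fin n) (Fin n) ℝ} {x : E n}
    (hA : EntriesDifferentiableAt A x) (hB : EntriesDifferentiableAt B x) (k : Fin n) :
    matrixPderiv (fun y => A y * B y) k x
      = matrixPderiv A k x * B x + A x * matrixPderiv B k x := by
  ext i j
  simp only [matrixPderiv, Matrix.of_apply, Matrix.add_apply, Matrix.mul_apply]
  rw [pderiv_sum fun l _ => (hA i l).fun_mul (hB l j), ← Finset.sum_add_distrib]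
  exact Finset.sum_congr rfl fun l _ => pderiv_mul (hA i l) (hB l j) k

theorem matrixPderiv_transpose (A : E n → Matrix (Fin n) (Fin n) ℝ) (k : Fin n) (x : E n) :
    matrixPderiv (fun y => (A y)ᵀ) k x = (matrixPderiv A k x)ᵀ := rfl

theorem matrixPderiv_const (A : Matrix (Fin n) (Fin n) ℝ) (k : Fin n) (x : E n) :
    matrixPderiv (fun _ => A) k x = 0 := by
  ext i j
  simp [matrixPderiv, pderiv_const]

theorem matrixPderiv_const_smul (c : ℝ) {A : E n → Matrix (Fin n) (Fin n) ℝ} {x : E n}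
    (hA : EntriesDifferentiableAt A x) (k : Fin n) :
    matrixPderiv (fun y => c • A y) k x = c • matrixPderiv A k x := by
  ext i j
  simp only [matrixPderiv, Matrix.of_apply, Matrix.smul_apply, smul_eq_mul]
  exact pderiv_const_mul c (hA i j) k

/-- The connection matrix `(Γ_k)^i_j = Γ^i_{kj}`. -/
def connectionMatrix (G : E n → Matrix (Fin n) (Fin n) ℝ) (x : E n) (k : Fin n) :
    Matrix (Fin n) (Fin n) ℝ :=
  Matrix.of fun i j => christoffel G x i k j

/-- The covariant derivative along the `k`-th coordinate vector. -/
def covPderiv (G A : E n → Matrix (Fin n) (Fin n) ℝ) (x : E n) (k : Fin n) :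
    Matrix (Fin n) (Fin n) ℝ :=
  matrixPderiv A k x + connectionMatrix G x k * A x - A x * connectionMatrix G x k

theorem covDeriv_eq_sum (G A : E n → Matrix (Fin n) (Fin n) ℝ) (x : E n) (u : Fin n → ℝ) :
    covDeriv G A x u = ∑ k, u k • covPderiv G A x k := by
  ext i j
  simp only [covDeriv, covPderiv, matrixPderiv, connectionMatrix, Matrix.of_apply,
    Matrix.sum_apply, Matrix.smul_apply, Matrix.add_apply, Matrix.sub_apply, Matrix.mul_apply,
    smul_eq_mul]
  refine Finset.sum_congr rfl fun k _ => ?_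
  congr 2
  exact Finset.sum_congr rfl fun l _ => mul_comm _ _

theorem covDeriv_single (G A : E n → Matrix (Fin n) (Fin n) ℝ) (x : E n) (k : Fin n) :
    covDeriv G A x (Pi.single k 1) = covPderiv G A x k := by
  rw [covDeriv_eq_sum, Finset.sum_eq_single k]
  · simp
  · intro l _ hl
    simp [hl]
  · simp

theorem tensorDTrace_eq_sum (A : E n → Matrix (Fin n) (Fin n) ℝ) (x : E n) (u : Fin n → ℝ) :
    tensorDTrace A x u = ∑ k, u k • tensorDTrace A x (Pi.single k 1) := by
  ext i j
  simp [tensorDTrace, Matrix.sum_apply, Pi.single_apply]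

theorem adjointWrt_smul (S B : Matrix (Fin n) (Fin n) ℝ) (c : ℝ) :
    adjointWrt S (c • B) = c • adjointWrt S B := by
  simp [adjointWrt]

theorem adjointWrt_sum {ι : Type*} (s : Finset ι) (S : Matrix (Fin n) (Fin n) ℝ)
    (B : ι → Matrix (Fin n) (Fin n) ℝ) :
    adjointWrt S (∑ i ∈ s, B i) = ∑ i ∈ s, adjointWrt S (B i) := by
  simp [adjointWrt, Matrix.transpose_sum, Finset.mul_sum, Finset.sum_mul]

/-- The compatibility equation need only be checked on coordinate vectors. -/
theorem covDeriv_eq_of_forall_single {G A : E n → Matrix (Fin n) (Fin n) ℝ} {x : E n}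
    (h : ∀ k, covPderiv G A x k = (1 / 2 : ℝ) • (tensorDTrace A x (Pi.single k 1)
      + adjointWrt (G x) (tensorDTrace A x (Pi.single k 1)))) (u : Fin n → ℝ) :
    covDeriv G A x u =
      (1 / 2 : ℝ) • (tensorDTrace A x u + adjointWrt (G x) (tensorDTrace A x u)) := by
  rw [covDeriv_eq_sum, tensorDTrace_eq_sum, adjointWrt_sum, ← Finset.sum_add_distrib,
    Finset.smul_sum]
  refine Finset.sum_congr rfl fun k _ => ?_
  rw [h k, adjointWrt_smul, ← smul_add, smul_comm]

/-- Lowering the index removes the inverse metric and leaves the Christoffel symbols of the first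
kind, which are linear in the derivatives of `G`. -/
theorem mul_connectionMatrix {G : E n → Matrix (Fin n) (Fin n) ℝ} {x : E n}
    (hdet : (G x).det ≠ 0) (k l j : Fin n) :
    (G x * connectionMatrix G x k) l j = (1 / 2) *
      (pderiv (fun y => G y l j) k x + pderiv (fun y => G y l k) j x
        - pderiv (fun y => G y k j) l x) := by
  have hunit : IsUnit (G x).det := isUnit_iff_ne_zero.mpr hdet
  set T : Fin n → ℝ := fun l => pderiv (fun y => G y l j) k x + pderiv (fun y => G y l k) j x
        - pderiv (fun y => G y k j) l x with hT
  have h1 : (fun i => connectionMatrix G x k i j) = (1 / 2 : ℝ) • ((G x)⁻¹ *ᵥ T) := by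
    ext i
    simp [connectionMatrix, christoffel, Matrix.mulVec, dotProduct, hT]
  have h2 : (G x * connectionMatrix G x k) l j = (G x *ᵥ (fun i => connectionMatrix G x k i j)) l :=
    rfl
  rw [h2, h1, Matrix.mulVec_smul, Matrix.mulVec_mulVec, Matrix.mul_nonsing_inv _ hunit]
  simp [hT]

theorem pderiv_entry_symm {G : E n → Matrix (Fin n) (Fin n) ℝ} {x : E n}
    (hsymm : ∀ᶠ y in 𝓝 x, (G y).IsSymm) (k i j : Fin n) :
    pderiv (fun y => G y i j) k x = pderiv (fun y => G y j i) k x :=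
  pderiv_congr (hsymm.mono fun _ hy => hy.apply j i) k

theorem connectionMatrix_comm {G : E n → Matrix (Fin n) (Fin n) ℝ} {x : E n}
    (hsymm : ∀ᶠ y in 𝓝 x, (G y).IsSymm) (i k j : Fin n) :
    connectionMatrix G x k i j = connectionMatrix G x j i k := by
  simp only [connectionMatrix, christoffel, Matrix.of_apply]
  congr 1
  refine Finset.sum_congr rfl fun l _ => ?_
  rw [pderiv_entry_symm hsymm l k j]
  ring

/-- The Levi-Civita connection is metric. -/
theorem matrixPderiv_metric {G : E n → Matrix (Fin n) (Fin n) ℝ} {x : E n}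
    (hsymm : ∀ᶠ y in 𝓝 x, (G y).IsSymm) (hdet : (G x).det ≠ 0) (k : Fin n) :
    matrixPderiv G k x = (connectionMatrix G x k)ᵀ * G x + G x * connectionMatrix G x k := by
  have h : (connectionMatrix G x k)ᵀ * G x = (G x * connectionMatrix G x k)ᵀ := by
    rw [Matrix.transpose_mul, hsymm.self_of_nhds.eq]
  ext i j
  rw [h, Matrix.add_apply, Matrix.transpose_apply, mul_connectionMatrix hdet,
    mul_connectionMatrix hdet, pderiv_entry_symm hsymm i k j, pderiv_entry_symm hsymm j k i,
    pderiv_entry_symm hsymm k j i]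
  simp only [matrixPderiv, Matrix.of_apply]
  ring

/-- The Levi-Civita connection is the only torsion-free metric connection. -/
theorem connectionMatrix_eq_of_metric_of_comm {G : E n → Matrix (Fin n) (Fin n) ℝ} {x : E n}
    (hsymm : ∀ᶠ y in 𝓝 x, (G y).IsSymm) (hdet : (G x).det ≠ 0)
    {C : Fin n → Matrix (Fin n) (Fin n) ℝ} (hcomm : ∀ i k j, C k i j = C j i k)
    (hmetric : ∀ k, matrixPderiv G k x = (C k)ᵀ * G x + G x * C k) (k : Fin n) :
    connectionMatrix G x k = C k := by
  have hunit : IsUnit (G x).det := isUnit_iff_ne_zero.mpr hdet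
  have hc : ∀ k l j, (G x * C k) l j = (G x * C j) l k := fun k l j => by
    simp only [Matrix.mul_apply]
    exact Finset.sum_congr rfl fun i _ => by rw [hcomm]
  have hm : ∀ k l j, pderiv (fun y => G y l j) k x = (G x * C k) j l + (G x * C k) l j := by
    intro k l j
    have h : (C k)ᵀ * G x = (G x * C k)ᵀ := by
      rw [Matrix.transpose_mul, hsymm.self_of_nhds.eq]
    have := congrFun (congrFun (hmetric k) l) j
    rw [h, Matrix.add_apply, Matrix.transpose_apply] at this
    exact this
  -- Koszul's formula: metricity expresses the three derivatives of `G` through `G * C`, and the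
  -- symmetry of `C` makes all terms but one cancel.
  have hG : G x * connectionMatrix G x k = G x * C k := by
    ext l j
    rw [mul_connectionMatrix hdet, hm, hm, hm, hc k j l, hc j k l, hc k l j]
    ring
  have := congrArg (fun B => (G x)⁻¹ * B) hG
  simpa [← Matrix.mul_assoc, Matrix.nonsing_inv_mul _ hunit] using this

end Calculus

/-! ### Algebra of the antidiagonal form, the Jordan block and the connection form. -/

section Frame

variable {n : ℕ}

/-- The matrix with ones on the antidiagonal. -/
def reversal (n : ℕ) : Matrix (Fin n) (Fin n) ℝ :=
  Matrix.of fun i j => if i.val + j.val + 1 = n then 1 else 0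

theorem reversal_mul_apply (M : Matrix (Fin n) (Fin n) ℝ) (i j : Fin n) :
    (reversal n * M) i j = M i.rev j := by
  rw [Matrix.mul_apply, Finset.sum_eq_single i.rev]
  · have : i.val + i.rev.val + 1 = n := by rw [Fin.val_rev]; omega
    simp only [reversal, Matrix.of_apply, if_pos this, one_mul]
  · intro l _ hl
    have : ¬ i.val + l.val + 1 = n := fun h => hl (Fin.ext (by rw [Fin.val_rev]; omega))
    simp only [reversal, Matrix.of_apply, if_neg this, zero_mul]
  · simp

theorem mul_reversal_apply (M : Matrix (Fin n) (Fin n) ℝ) (i j : Fin n) :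
    (M * reversal n) i j = M i j.rev := by
  rw [Matrix.mul_apply, Finset.sum_eq_single j.rev]
  · have : j.rev.val + j.val + 1 = n := by rw [Fin.val_rev]; omega
    simp only [reversal, Matrix.of_apply, if_pos this, mul_one]
  · intro l _ hl
    have : ¬ l.val + j.val + 1 = n := fun h => hl (Fin.ext (by rw [Fin.val_rev]; omega))
    simp only [reversal, Matrix.of_apply, if_neg this, mul_zero]
  · simp

theorem reversal_mul_self : reversal n * reversal n = 1 := by
  ext i j
  rw [reversal_mul_apply]
  simp only [reversal, Matrix.of_apply, Matrix.one_apply, Fin.val_rev, Fin.ext_iff]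
  exact if_congr (by omega) rfl rfl

theorem reversal_transpose : (reversal n)ᵀ = reversal n := by
  ext i j
  simp only [reversal, Matrix.of_apply, Matrix.transpose_apply]
  exact if_congr (by omega) rfl rfl

theorem reversal_det_ne_zero : (reversal n).det ≠ 0 := fun h => by
  have := congrArg Matrix.det (reversal_mul_self (n := n))
  simp [h] at this

theorem jordanBlock_eq (c : ℝ) : jordanBlock n c = c • 1 + jordanBlock n 0 := by
  ext i j
  by_cases h : i = j
  · subst h
    simp [jordanBlock]
  · simp [jordanBlock, h]

theorem jordanBlock_zero_mul_apply (M : Matrix (Fin n) (Fin n) ℝ) (i j : Fin n) :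
    (jordanBlock n 0 * M) i j = if h : i.val + 1 < n then M ⟨i.val + 1, h⟩ j else 0 := by
  rw [Matrix.mul_apply]
  split_ifs with h
  · rw [Finset.sum_eq_single ⟨i.val + 1, h⟩]
    · simp [jordanBlock, Fin.ext_iff]
    · intro l _ hl
      have : ¬ l.val = i.val + 1 := fun h' => hl (Fin.ext h')
      simp [jordanBlock, this]
    · simp
  · refine Finset.sum_eq_zero fun l _ => ?_
    have : ¬ l.val = i.val + 1 := by omega
    simp [jordanBlock, this]

theorem mul_jordanBlock_zero_apply (M : Matrix (Fin n) (Fin n) ℝ) (i j : Fin n) :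
    (M * jordanBlock n 0) i j
      = if 1 ≤ j.val then M i ⟨j.val - 1, by omega⟩ else 0 := by
  rw [Matrix.mul_apply]
  split_ifs with h
  · rw [Finset.sum_eq_single ⟨j.val - 1, by omega⟩]
    · have : j.val = j.val - 1 + 1 := by omega
      have h' : ¬ (⟨j.val - 1, by omega⟩ : Fin n) = j := fun e => by
        have := congrArg Fin.val e
        simp only at this
        omega
      simp [jordanBlock, ← this, h']
    · intro l _ hl
      have : ¬ j.val = l.val + 1 := fun h' => hl (Fin.ext (by simp; omega))
      simp [jordanBlock, this]
    · simp
  · refine Finset.sum_eq_zero fun l _ => ?_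
    have : ¬ j.val = l.val + 1 := by omega
    simp [jordanBlock, this]

theorem trace_jordanBlock (c : ℝ) : (jordanBlock n c).trace = n * c := by
  simp [Matrix.trace, jordanBlock]

/-- Comparing entries of the two products gives `W_{m+1,i} = W_{m,i-1}`, and `0` when `i = 0`. Hence
`W` is upper triangular Toeplitz, determined by its first row, i.e. a polynomial in the block. -/
theorem apply_of_commute_jordanBlock_zero {W : Matrix (Fin n) (Fin n) ℝ}
    (hW : W * jordanBlock n 0 = jordanBlock n 0 * W) :
    ∀ (m : ℕ) (hm : m < n) (i : Fin n), W ⟨m, hm⟩ i =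
      if m ≤ i.val then W ⟨0, by omega⟩ ⟨i.val - m, by omega⟩ else 0 := by
  intro m
  induction m with
  | zero => intro hm i; simp
  | succ m ih =>
    intro hm i
    have h := congrFun (congrFun hW ⟨m, by omega⟩) i
    rw [mul_jordanBlock_zero_apply, jordanBlock_zero_mul_apply, dif_pos hm] at h
    rw [← h]
    by_cases hi : 1 ≤ i.val
    · rw [if_pos hi, ih]
      have : (m ≤ i.val - 1) ↔ (m + 1 ≤ i.val) := by omega
      simp only [this]
      refine if_congr Iff.rfl ?_ rfl
      congr 2
      omega
    · rw [if_neg hi, if_neg (by omega)]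

/-- A matrix commuting with a full nilpotent Jordan block and skew with respect to the
antidiagonal form vanishes. -/
theorem eq_zero_of_commute_of_skew {W : Matrix (Fin n) (Fin n) ℝ}
    (hW : W * jordanBlock n 0 = jordanBlock n 0 * W)
    (hskew : Wᵀ * reversal n + reversal n * W = 0) : W = 0 := by
  -- The Toeplitz shape makes `reversal n * W` symmetric, whereas `hskew` makes it antisymmetric.
  have hsym : ∀ i j : Fin n, W i.rev j = W j.rev i := fun i j => by
    have h := apply_of_commute_jordanBlock_zero hW
    rw [h i.rev.val i.rev.isLt j, h j.rev.val j.rev.isLt i]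
    simp only [Fin.val_rev]
    refine if_congr (by omega) ?_ rfl
    congr 2
    omega
  ext i j
  have h := congrFun (congrFun hskew i.rev) j
  rw [Matrix.add_apply, mul_reversal_apply, reversal_mul_apply, Matrix.transpose_apply,
    ← hsym] at h
  simp only [Fin.rev_rev, Matrix.zero_apply] at h ⊢
  linarith

/-- The extension by zero of a vector to all natural indices. -/
def extendZero (c : Fin n → ℝ) (k : ℕ) : ℝ := if h : k < n then c ⟨k, h⟩ else 0

theorem extendZero_val (c : Fin n → ℝ) (i : Fin n) : extendZero c i.val = c i := by
  simp [extendZero]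

/-- The connection form, in the canonical frame, of a metric compatible with a Jordan block, where
`c` are the frame components of the direction and `μ` is the derivative of the eigenvalue along the
last frame vector. -/
def frameConnection (μ : ℝ) (c : Fin n → ℝ) : Matrix (Fin n) (Fin n) ℝ :=
  Matrix.of fun m i => μ *
    ((if m.val = i.val + 1 then (m.val - n / 2 : ℝ) * extendZero c (n - 1) else 0)
      + (if m.val = 0 ∧ i.val + 1 < n then (n / 2 : ℝ) * extendZero c (n - 2 - i.val) else 0)
      - (if i.val + 1 = n ∧ 1 ≤ m.val then (n / 2 : ℝ) * extendZero c (m.val - 1) else 0))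

/-- Reflection in the antidiagonal exchanges the first-row and last-column terms, which carry
opposite signs. On the subdiagonal it pairs weights `m - n/2` and `m' - n/2` with `m + m' = n`, so
they cancel. -/
theorem frameConnection_skew (μ : ℝ) (c : Fin n → ℝ) :
    (frameConnection μ c)ᵀ * reversal n + reversal n * frameConnection μ c = 0 := by
  ext i j
  rw [Matrix.add_apply, mul_reversal_apply, reversal_mul_apply, Matrix.transpose_apply,
    Matrix.zero_apply]
  obtain ⟨i, hi⟩ := i
  obtain ⟨j, hj⟩ := j
  simp only [frameConnection, Matrix.of_apply, Fin.val_rev]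
  have e1 : (n - (j + 1) = i + 1) ↔ (n - (i + 1) = j + 1) := by omega
  have e2 : (n - (j + 1) = 0 ∧ i + 1 < n) ↔ (j + 1 = n ∧ 1 ≤ n - (i + 1)) := by omega
  have e3 : (i + 1 = n ∧ 1 ≤ n - (j + 1)) ↔ (n - (i + 1) = 0 ∧ j + 1 < n) := by omega
  have e4 : n - (i + 1) - 1 = n - 2 - i := by omega
  have e5 : n - (j + 1) - 1 = n - 2 - j := by omega
  simp only [e1, e2, e3, e4, e5]
  by_cases h : n - (i + 1) = j + 1
  · have h1 : ((n - (j + 1) : ℕ) : ℝ) + (n - (i + 1) : ℕ) = n := by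
      rw [← Nat.cast_add]; congr 1; omega
    rw [if_pos h, if_pos h]
    linear_combination μ * extendZero c (n - 1) * h1
  · rw [if_neg h, if_neg h]
    ring

/-- Consecutive subdiagonal weights differ by `1`, so their bracket with the block cancels the
scalar matrix `dλ(u)` along the diagonal, except at its two ends, where `n / 2` remains. The first
row and last column of `frameConnection` supply the rest of the right side. This is the
compatibility equation in the canonical frame. -/
theorem frameConnection_bracket (μ : ℝ) (c : Fin n → ℝ) :
    frameConnection μ c * jordanBlock n 0 - jordanBlock n 0 * frameConnection μ c
        + (μ * extendZero c (n - 1)) • (1 : Matrix (Fin n) (Fin n) ℝ)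
      = Matrix.of fun m i => (n / 2 : ℝ) * μ *
        ((if i.val + 1 = n then c m else 0) + (if m.val = 0 then c i.rev else 0)) := by
  ext m i
  rw [Matrix.add_apply, Matrix.sub_apply, mul_jordanBlock_zero_apply, jordanBlock_zero_mul_apply,
    Matrix.smul_apply]
  simp only [Matrix.of_apply, Matrix.one_apply, smul_eq_mul]
  rw [← extendZero_val c m, ← extendZero_val c i.rev]
  obtain ⟨m, hm⟩ := m
  obtain ⟨i, hi⟩ := i
  simp only [frameConnection, Matrix.of_apply, Fin.val_rev, Fin.mk.injEq]
  by_cases hi1 : 1 ≤ i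
  · have f1 : (m = i - 1 + 1) ↔ m = i := by omega
    have f2 : n - 2 - (i - 1) = n - (i + 1) := by omega
    have f3 : (m = 0 ∧ i - 1 + 1 < n) ↔ m = 0 := by omega
    have f4 : ¬ (i - 1 + 1 = n ∧ 1 ≤ m) := by omega
    have f5 : (m + 1 = i + 1) ↔ m = i := by omega
    have f6 : ¬ (m + 1 = 0 ∧ i + 1 < n) := by omega
    have f7 : (i + 1 = n ∧ 1 ≤ m + 1) ↔ i + 1 = n := by omega
    simp only [if_pos hi1, f1, f2, f3, if_neg f4, f5, if_neg f6, f7, Nat.add_sub_cancel]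
    by_cases hmn : m + 1 < n
    · rw [dif_pos hmn]
      by_cases hmi : m = i
      · subst hmi
        have : ¬ m + 1 = n := by omega
        have h0 : ¬ m = 0 := by omega
        simp [this, h0]
        ring
      · simp only [hmi, if_false]
        split_ifs <;> ring
    · rw [dif_neg hmn]
      -- Last row: the shifted row is missing, so the subdiagonal weight `(n - 1) - n/2` and the
      -- scalar `1` add up to `n/2`.
      have hm' : m = n - 1 := by omega
      have h0 : ¬ m = 0 := by omega
      by_cases hmi : m = i
      · subst hmi
        have h1 : m + 1 = n := by omega
        have h2 : (n : ℝ) = m + 1 := by rw [← h1]; simp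
        simp only [if_true, h0, if_false, h1]
        rw [hm', h2] 
        have h3 : ((n - 1 : ℕ) : ℝ) = m := by rw [hm']
        rw [h3]
        ring
      · have h1 : ¬ i + 1 = n := by omega
        simp [hmi, h0, h1]
  · have hi0 : i = 0 := by omega
    subst hi0
    simp only [if_neg hi1]
    have f5 : (m + 1 = 0 + 1) ↔ m = 0 := by omega
    have f6 : ¬ (m + 1 = 0 ∧ 0 + 1 < n) := by omega
    have f7 : (0 + 1 = n ∧ 1 ≤ m + 1) ↔ 0 + 1 = n := by omega
    simp only [f5, if_neg f6, f7, Nat.add_sub_cancel]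
    by_cases hmn : m + 1 < n
    · have : ¬ 0 + 1 = n := by omega
      rw [dif_pos hmn]
      by_cases hm0 : m = 0
      · subst hm0
        simp [this]
        ring
      · simp [hm0, this]
    · rw [dif_neg hmn]
      by_cases hm0 : m = 0
      · have h1 : n = 1 := by omega
        subst hm0 h1
        simp
        ring
      · have : ¬ 0 + 1 = n := by omega
        simp [hm0, this]

/-- The left side is the torsion term `W(c) d - W(d) c`. The multiples of `n / 2` cancel and only
the factor `m` survives, which is the coefficient in the structure equations. For `m = 0` the
truncated index `m - 1` is harmless because of that factor. -/
theorem frameConnection_mulVec_sub (μ : ℝ) (c d : Fin n → ℝ) (m : Fin n) :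
    (frameConnection μ c *ᵥ d) m - (frameConnection μ d *ᵥ c) m = m.val * μ *
      (extendZero c (n - 1) * extendZero d (m.val - 1)
        - extendZero d (n - 1) * extendZero c (m.val - 1)) := by
  have hn : 0 < n := m.pos
  have key : ∀ c d : Fin n → ℝ, (frameConnection μ c *ᵥ d) m =
      if m.val = 0 then μ * (n / 2) *
        ∑ i ∈ Finset.range (n - 1), extendZero c (n - 2 - i) * extendZero d i
      else μ * ((m.val - n / 2) * extendZero c (n - 1) * extendZero d (m.val - 1)
        - n / 2 * extendZero c (m.val - 1) * extendZero d (n - 1)) := by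
    intro c d
    simp only [Matrix.mulVec, dotProduct, frameConnection, Matrix.of_apply]
    have hsum : ∀ f : ℕ → ℝ, ∑ i : Fin n, f i.val * d i
        = ∑ i ∈ Finset.range n, f i * extendZero d i := fun f => by
      rw [Finset.sum_range]
      exact Finset.sum_congr rfl fun i _ => by rw [extendZero_val]
    rw [hsum fun i => μ *
      ((if m.val = i + 1 then (m.val - n / 2 : ℝ) * extendZero c (n - 1) else 0)
      + (if m.val = 0 ∧ i + 1 < n then (n / 2 : ℝ) * extendZero c (n - 2 - i) else 0)
      - (if i + 1 = n ∧ 1 ≤ m.val then (n / 2 : ℝ) * extendZero c (m.val - 1) else 0))]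
    by_cases hm : m.val = 0
    · rw [if_pos hm, Finset.mul_sum]
      obtain ⟨k, rfl⟩ : ∃ k, n = k + 1 := ⟨n - 1, by omega⟩
      rw [Finset.sum_range_succ]
      simp only [hm, Nat.add_sub_cancel, true_and, Nat.zero_ne_add_one, if_false, zero_add,
        lt_irrefl, nonpos_iff_eq_zero, one_ne_zero, and_false, sub_zero, mul_zero, zero_mul,
        add_zero]
      refine Finset.sum_congr rfl fun i hi => ?_
      rw [if_pos (by simpa using hi)]
      ring
    · rw [if_neg hm]
      have h1 : 1 ≤ m.val := by omega
      have h2 : ∀ i, m.val = i + 1 ↔ i = m.val - 1 := by omega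
      have h3 : ∀ i, i + 1 = n ↔ i = n - 1 := by omega
      simp only [hm, h1, false_and, and_true, if_false, add_zero, h2, h3, mul_sub, sub_mul,
        Finset.sum_sub_distrib, mul_ite, ite_mul, mul_zero, zero_mul, Finset.sum_ite_eq',
        Finset.mem_range]
      rw [if_pos (by omega), if_pos (by omega)]
      ring
  rw [key, key]
  by_cases hm : m.val = 0
  · rw [if_pos hm, if_pos hm, hm]
    -- In row `0` the pairing `∑ c_{n-2-i} d_i` is symmetric in `c` and `d`, as the reflection `i ↦
    -- n - 2 - i` shows.
    rw [← Finset.sum_range_reflect (fun i => extendZero d (n - 2 - i) * extendZero c i)]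
    have : ∀ i ∈ Finset.range (n - 1), extendZero c (n - 2 - i) * extendZero d i =
        extendZero d (n - 2 - (n - 1 - 1 - i)) * extendZero c (n - 1 - 1 - i) := fun i hi => by
      have : i < n - 1 := by simpa using hi
      have e1 : n - 2 - (n - 1 - 1 - i) = i := by omega
      have e2 : n - 1 - 1 - i = n - 2 - i := by omega
      rw [e1, e2, mul_comm]
    rw [Finset.sum_congr rfl this]
    simp
  · rw [if_neg hm, if_neg hm]
    ring

end Frame

/-! ### Compatibility in a coframe and the structure equations. -/

section FrameEquations

variable {n : ℕ}

theorem reversal_mul_jordanBlock_mul_reversal :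
    reversal n * jordanBlock n 0 * reversal n = (jordanBlock n 0)ᵀ := by
  ext i j
  rw [mul_reversal_apply, reversal_mul_apply, Matrix.transpose_apply]
  have h : (n - (j.val + 1) = n - (i.val + 1) + 1) ↔ i.val = j.val + 1 := by omega
  have h' : (n - (i.val + 1) = n - (j.val + 1)) ↔ j.val = i.val := by omega
  simp only [jordanBlock, Matrix.of_apply, Fin.val_rev, Fin.ext_iff, h, h']

theorem det_ne_zero_of_eq_smul {ε : ℝ} {G K : Matrix (Fin n) (Fin n) ℝ} (hdet : G.det ≠ 0)
    (hG : G = ε • (Kᵀ * reversal n * K)) : K.det ≠ 0 := fun h => hdet <| by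
  have hn : G.det = ε ^ n * (K.det * (reversal n).det * K.det) := by
    rw [hG]
    simp
  rw [hn, h]
  simp

theorem inv_of_eq_smul {ε : ℝ} (hε : ε ≠ 0) {G K : Matrix (Fin n) (Fin n) ℝ} (hK : K.det ≠ 0)
    (hG : G = ε • (Kᵀ * reversal n * K)) : G⁻¹ = ε⁻¹ • (K⁻¹ * reversal n * (K⁻¹)ᵀ) := by
  have hu : IsUnit K.det := isUnit_iff_ne_zero.mpr hK
  refine Matrix.inv_eq_right_inv ?_
  rw [hG, Matrix.smul_mul, Matrix.mul_smul, smul_smul, mul_inv_cancel₀ hε, one_smul]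
  have h1 : K * K⁻¹ = 1 := Matrix.mul_nonsing_inv _ hu
  have h2 : Kᵀ * (K⁻¹)ᵀ = 1 := by rw [← Matrix.transpose_mul, Matrix.nonsing_inv_mul _ hu,
    Matrix.transpose_one]
  calc Kᵀ * reversal n * K * (K⁻¹ * reversal n * (K⁻¹)ᵀ)
      = Kᵀ * reversal n * (K * K⁻¹) * reversal n * (K⁻¹)ᵀ := by simp only [Matrix.mul_assoc]
    _ = 1 := by
      rw [h1, Matrix.mul_one, Matrix.mul_assoc Kᵀ, reversal_mul_self, Matrix.mul_one, h2]

/-- The adjoint in terms of a coframe in which the metric is `±` the antidiagonal form. -/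
theorem coframe_adjointWrt {ε : ℝ} (hε : ε ≠ 0) {G K : Matrix (Fin n) (Fin n) ℝ}
    (hK : K.det ≠ 0) (hG : G = ε • (Kᵀ * reversal n * K)) (B : Matrix (Fin n) (Fin n) ℝ) :
    K * adjointWrt G B * K⁻¹ = reversal n * (K * B * K⁻¹)ᵀ * reversal n := by
  have hu : IsUnit K.det := isUnit_iff_ne_zero.mpr hK
  have h1 : K * K⁻¹ = 1 := Matrix.mul_nonsing_inv _ hu
  rw [adjointWrt, inv_of_eq_smul hε hK hG]
  nth_rewrite 1 [hG]
  rw [Matrix.smul_mul, Matrix.smul_mul, Matrix.mul_smul (K⁻¹ * reversal n * (K⁻¹)ᵀ * Bᵀ),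
    smul_smul, inv_mul_cancel₀ hε, one_smul]
  calc K * (K⁻¹ * reversal n * (K⁻¹)ᵀ * Bᵀ * (Kᵀ * reversal n * K)) * K⁻¹
      = (K * K⁻¹) * (reversal n * ((K⁻¹)ᵀ * Bᵀ * Kᵀ) * reversal n) * (K * K⁻¹) := by
        simp only [Matrix.mul_assoc]
    _ = _ := by
      rw [h1, Matrix.one_mul, Matrix.mul_one, Matrix.transpose_mul, Matrix.transpose_mul]
      simp only [Matrix.mul_assoc]

variable {U : Set (E n)} {G A K : E n → Matrix (Fin n) (Fin n) ℝ} {lam : E n → ℝ} {ε : ℝ} {x : E n}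

theorem matrixPderiv_jordanBlock (lam : E n → ℝ) (x : E n) (k : Fin n) :
    matrixPderiv (fun y => jordanBlock n (lam y)) k x = pderiv lam k x • 1 := by
  ext i j
  simp only [matrixPderiv, jordanBlock, Matrix.of_apply, Matrix.smul_apply, Matrix.one_apply]
  by_cases h : i = j
  · simp [h]
  · simp [h, pderiv_const]

theorem entriesDifferentiableAt_jordanBlock (hlam : DifferentiableAt ℝ lam x) :
    EntriesDifferentiableAt (fun y => jordanBlock n (lam y)) x := fun i j => by
  simp only [jordanBlock, Matrix.of_apply]
  by_cases h : i = j
  · simpa [h] using hlam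
  · simp [h]

/-- The covariant derivative of a Jordan block in terms of its coframe. -/
theorem coframe_covPderiv (hK : EntriesDifferentiableAt K x) (hA : EntriesDifferentiableAt A x)
    (hlam : DifferentiableAt ℝ lam x) (hdet : (K x).det ≠ 0)
    (hKA : ∀ᶠ y in 𝓝 x, K y * A y = jordanBlock n (lam y) * K y)
    {W : Matrix (Fin n) (Fin n) ℝ} {k : Fin n}
    (hW : K x * connectionMatrix G x k = W * K x + matrixPderiv K k x) :
    K x * covPderiv G A x k * (K x)⁻¹
      = W * jordanBlock n 0 - jordanBlock n 0 * W + pderiv lam k x • 1 := by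
  have hu : IsUnit (K x).det := isUnit_iff_ne_zero.mpr hdet
  have h1 : K x * (K x)⁻¹ = 1 := Matrix.mul_nonsing_inv _ hu
  -- Differentiating `K A = J K` expresses the derivative of `A` through those of `K` and of the
  -- eigenvalue; the derivatives of `K` then cancel against the inhomogeneous term in `hW`.
  have hd := matrixPderiv_congr hKA k
  rw [matrixPderiv_mul hK hA, matrixPderiv_mul (entriesDifferentiableAt_jordanBlock hlam) hK,
    matrixPderiv_jordanBlock] at hd
  have hx := hKA.self_of_nhds
  have key : K x * covPderiv G A x k
      = (W * jordanBlock n (lam x) - jordanBlock n (lam x) * W + pderiv lam k x • 1) * K x := by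
    have e1 : K x * covPderiv G A x k = K x * matrixPderiv A k x
        + K x * connectionMatrix G x k * A x - K x * A x * connectionMatrix G x k := by
      rw [covPderiv]
      noncomm_ring
    have e2 : K x * matrixPderiv A k x = pderiv lam k x • 1 * K x
        + jordanBlock n (lam x) * matrixPderiv K k x - matrixPderiv K k x * A x := by
      rw [← hd]
      abel
    have e3 : K x * A x * connectionMatrix G x k
        = jordanBlock n (lam x) * (W * K x + matrixPderiv K k x) := by
      rw [hx, Matrix.mul_assoc, hW]
    have e4 : W * K x * A x = W * jordanBlock n (lam x) * K x := by
      rw [Matrix.mul_assoc, hx, Matrix.mul_assoc]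
    rw [e1, e2, e3, hW, Matrix.add_mul, e4]
    noncomm_ring
  rw [key, Matrix.mul_assoc, h1, Matrix.mul_one, jordanBlock_eq (lam x)]
  simp only [Matrix.mul_add, Matrix.add_mul, Matrix.smul_mul, Matrix.mul_smul, Matrix.one_mul,
    Matrix.mul_one]
  abel

theorem trace_eq_of_coframe {A K : Matrix (Fin n) (Fin n) ℝ} {c : ℝ} (hdet : K.det ≠ 0)
    (hKA : K * A = jordanBlock n c * K) : A.trace = n * c := by
  have hu : IsUnit K.det := isUnit_iff_ne_zero.mpr hdet
  have h1 : K * K⁻¹ = 1 := Matrix.mul_nonsing_inv _ hu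
  have h2 : K⁻¹ * K = 1 := Matrix.nonsing_inv_mul _ hu
  calc A.trace = (K⁻¹ * K * A).trace := by rw [h2, Matrix.one_mul]
    _ = (K⁻¹ * (jordanBlock n c * K)).trace := by rw [Matrix.mul_assoc, hKA]
    _ = (jordanBlock n c).trace := by
      rw [Matrix.trace_mul_comm, Matrix.mul_assoc, h1, Matrix.mul_one]
    _ = n * c := trace_jordanBlock c

/-- The differential of `tr L` in terms of the coframe. -/
theorem coframe_tensorDTrace (hlam : DifferentiableAt ℝ lam x)
    (hdet : ∀ᶠ y in 𝓝 x, (K y).det ≠ 0)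
    (hKA : ∀ᶠ y in 𝓝 x, K y * A y = jordanBlock n (lam y) * K y) (k : Fin n) :
    K x * tensorDTrace A x (Pi.single k 1) * (K x)⁻¹
      = (n : ℝ) • Matrix.vecMulVec (fun m => K x m k)
        ((fun j => pderiv lam j x) ᵥ* (K x)⁻¹) := by
  have ht : ∀ j, pderiv (fun y => (A y).trace) j x = n * pderiv lam j x := fun j => by
    rw [← pderiv_const_mul _ hlam]
    refine pderiv_congr ?_ j
    filter_upwards [hdet, hKA] with y h1 h2 using trace_eq_of_coframe h1 h2
  have h : tensorDTrace A x (Pi.single k 1)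
      = (n : ℝ) • Matrix.vecMulVec (Pi.single k 1) (fun j => pderiv lam j x) := by
    ext i j
    simp only [tensorDTrace, Matrix.of_apply, ht, Matrix.smul_apply, Matrix.vecMulVec_apply,
      smul_eq_mul]
    ring
  rw [h, Matrix.mul_smul, Matrix.smul_mul, Matrix.mul_vecMulVec, Matrix.vecMulVec_mul,
    Matrix.mulVec_single_one]
  rfl

/-- When `ℓ` is concentrated in the last entry, `c ⊗ ℓ` fills the last column, and its adjoint for
the antidiagonal form fills the first row with the reversed `c`. -/
theorem coframe_compatibility_rhs {ℓ c : Fin n → ℝ} {μ : ℝ}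
    (hℓ : ∀ i : Fin n, ℓ i = if i.val + 1 = n then μ else 0) :
    (1 / 2 : ℝ) • ((n : ℝ) • Matrix.vecMulVec c ℓ
      + reversal n * ((n : ℝ) • Matrix.vecMulVec c ℓ)ᵀ * reversal n)
      = Matrix.of fun m i => (n / 2 : ℝ) * μ *
        ((if i.val + 1 = n then c m else 0) + (if m.val = 0 then c i.rev else 0)) := by
  ext m i
  simp only [Matrix.smul_apply, Matrix.add_apply, mul_reversal_apply, reversal_mul_apply,
    Matrix.transpose_apply, Matrix.vecMulVec_apply, Matrix.of_apply, hℓ, Fin.val_rev, smul_eq_mul]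
  have : (n - (m.val + 1) + 1 = n) ↔ m.val = 0 := by omega
  simp only [this]
  split_ifs <;> ring

/-- Here `W` is the gauge transform of the connection matrix `C`, with `D` and `P` in the roles of
the derivatives of `K` and `G`. The defect `Cᵀ G + G C - P` equals `ε Kᵀ (Wᵀ R + R W) K` with `R =
reversal n`, and `K` is invertible. -/
theorem skew_of_metric {G K P : Matrix (Fin n) (Fin n) ℝ} {C W D : Matrix (Fin n) (Fin n) ℝ}
    (hε : ε ≠ 0) (hdet : K.det ≠ 0) (hG : G = ε • (Kᵀ * reversal n * K))
    (hP : P = ε • (Dᵀ * reversal n * K + Kᵀ * reversal n * D)) (hW : K * C = W * K + D) :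
    P = Cᵀ * G + G * C ↔ Wᵀ * reversal n + reversal n * W = 0 := by
  have hu : IsUnit K.det := isUnit_iff_ne_zero.mpr hdet
  have h1 : K * K⁻¹ = 1 := Matrix.mul_nonsing_inv _ hu
  have h2 : (K⁻¹)ᵀ * Kᵀ = 1 := by rw [← Matrix.transpose_mul, h1, Matrix.transpose_one]
  have hC : Cᵀ * Kᵀ = Kᵀ * Wᵀ + Dᵀ := by
    rw [← Matrix.transpose_mul, hW, Matrix.transpose_add, Matrix.transpose_mul]
  have e : Cᵀ * G + G * C - P = ε • (Kᵀ * (Wᵀ * reversal n + reversal n * W) * K) := by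
    have e1 : Cᵀ * G = ε • ((Kᵀ * Wᵀ + Dᵀ) * reversal n * K) := by
      rw [hG, Matrix.mul_smul, ← hC]
      simp only [Matrix.mul_assoc]
    have e2 : G * C = ε • (Kᵀ * reversal n * (W * K + D)) := by
      rw [hG, Matrix.smul_mul, ← hW]
      simp only [Matrix.mul_assoc]
    rw [e1, e2, hP, ← smul_add, ← smul_sub]
    congr 1
    noncomm_ring
  constructor
  · intro h
    rw [← h, sub_self] at e
    have e' := (smul_eq_zero.mp e.symm).resolve_left hε
    have := congrArg (fun M => (K⁻¹)ᵀ * M * K⁻¹) e'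
    simp only [Matrix.mul_zero, Matrix.zero_mul] at this
    rw [← this]
    calc Wᵀ * reversal n + reversal n * W
        = ((K⁻¹)ᵀ * Kᵀ) * (Wᵀ * reversal n + reversal n * W) * (K * K⁻¹) := by
          rw [h1, h2, Matrix.one_mul, Matrix.mul_one]
      _ = _ := by simp only [Matrix.mul_assoc]
  · intro h
    rw [h, Matrix.mul_zero, Matrix.zero_mul, smul_zero] at e
    exact (sub_eq_zero.mp e).symm

theorem matrixPderiv_coframe_metric (hK : EntriesDifferentiableAt K x)
    (hG : ∀ᶠ y in 𝓝 x, G y = ε • ((K y)ᵀ * reversal n * K y)) (k : Fin n) :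
    matrixPderiv G k x = ε • ((matrixPderiv K k x)ᵀ * reversal n * K x
      + (K x)ᵀ * reversal n * matrixPderiv K k x) := by
  have hc := entriesDifferentiableAt_const (reversal n) x
  rw [matrixPderiv_congr hG, matrixPderiv_const_smul _ ((hK.transpose.mul hc).mul hK),
    matrixPderiv_mul (hK.transpose.mul hc) hK, matrixPderiv_mul hK.transpose hc,
    matrixPderiv_const, matrixPderiv_transpose, Matrix.mul_zero, add_zero]

/-- The differential of the eigenvalue annihilates the image of the nilpotent part. -/
theorem vecMul_inv_eq_of_compatible {c : Fin n → Fin n → ℝ} {ℓ : Fin n → ℝ}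
    {K : Matrix (Fin n) (Fin n) ℝ} {d : Fin n → ℝ} {W : Fin n → Matrix (Fin n) (Fin n) ℝ}
    (hdet : K.det ≠ 0) (hc : ∀ k m, c k m = K m k)
    (h : ∀ k, W k * jordanBlock n 0 - jordanBlock n 0 * W k + d k • 1
      = (1 / 2 : ℝ) • ((n : ℝ) • Matrix.vecMulVec (c k) ℓ
        + reversal n * ((n : ℝ) • Matrix.vecMulVec (c k) ℓ)ᵀ * reversal n)) (i : Fin n)
    (hi : i.val + 1 < n) : ℓ i = 0 := by
  have hu : IsUnit K.det := isUnit_iff_ne_zero.mpr hdet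
  have h1 : K * K⁻¹ = 1 := Matrix.mul_nonsing_inv _ hu
  set S := jordanBlock n 0 with hS
  have hn : (n : ℝ) ≠ 0 := by
    have := i.pos
    positivity
  -- Multiply the equation by `S` and take traces. The commutator and the scalar term drop out,
  -- since `tr (S [W, S]) = 0` and `tr S = 0`. The rank-one matrix and its adjoint contribute
  -- equally, because `S` is selfadjoint for the antidiagonal form.
  have htr : ∀ k, (ℓ ᵥ* S) ⬝ᵥ c k = 0 := by
    intro k
    have hk := congrArg (fun M => (S * M).trace) (h k)
    have hl : (S * (W k * S - S * W k + d k • 1)).trace = 0 := by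
      rw [Matrix.mul_add, Matrix.mul_sub, Matrix.trace_add, Matrix.trace_sub, ← Matrix.mul_assoc,
        Matrix.trace_mul_comm (S * W k) S]
      simp [hS, trace_jordanBlock]
    have hm : (S * (reversal n * (Matrix.vecMulVec (c k) ℓ)ᵀ * reversal n)).trace
        = (S * Matrix.vecMulVec (c k) ℓ).trace := by
      rw [← Matrix.mul_assoc, Matrix.trace_mul_comm, ← Matrix.mul_assoc, ← Matrix.mul_assoc,
        hS, reversal_mul_jordanBlock_mul_reversal, ← Matrix.transpose_mul, Matrix.trace_transpose,
        Matrix.trace_mul_comm]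
    have hv : (S * Matrix.vecMulVec (c k) ℓ).trace = (ℓ ᵥ* S) ⬝ᵥ c k := by
      rw [Matrix.mul_vecMulVec, Matrix.trace_vecMulVec, dotProduct_comm, Matrix.dotProduct_mulVec]
    simp only [hl] at hk
    simp only [Matrix.mul_smul, Matrix.mul_add, Matrix.trace_smul, Matrix.trace_add,
      Matrix.transpose_smul, Matrix.smul_mul, hm, hv, smul_eq_mul] at hk
    have : (n : ℝ) * ((ℓ ᵥ* S) ⬝ᵥ c k) = 0 := by linarith
    exact (mul_eq_zero.mp this).resolve_left hn
  -- The vectors `c k` are the columns of the invertible `K`, so a covector that kills all of them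
  -- is zero.
  have hz : (ℓ ᵥ* S) ᵥ* K = 0 := by
    ext k
    have := htr k
    simpa [Matrix.vecMul, dotProduct, hc] using this
  have hz' : ℓ ᵥ* S = 0 := by
    have := congrArg (fun v => v ᵥ* K⁻¹) hz
    simpa [Matrix.vecMul_vecMul, Matrix.mul_assoc, h1] using this
  have := congrFun hz' ⟨i.val + 1, hi⟩
  rw [Matrix.vecMul, dotProduct, Finset.sum_eq_single i] at this
  · simpa [hS, jordanBlock, Fin.ext_iff] using this
  · intro l _ hl
    have h' : ¬ i.val = l.val := fun e => hl (Fin.ext e.symm)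
    simp [hS, jordanBlock, h']
  · simp

/-- The structure equations of the canonical coframe of a compatible Jordan block. -/
theorem coframe_structure (hU : IsOpen U) (hG : IsMetricOn U G) (hA : IsCompatibleOn U G A)
    (hε : ε ≠ 0) (hK : ∀ y ∈ U, EntriesDifferentiableAt K y)
    (hlam : ∀ y ∈ U, DifferentiableAt ℝ lam y)
    (hGK : ∀ y ∈ U, G y = ε • ((K y)ᵀ * reversal n * K y))
    (hKA : ∀ y ∈ U, K y * A y = jordanBlock n (lam y) * K y) (hx : x ∈ U) :
    ∃ μ : ℝ, (∀ k, pderiv lam k x = μ * extendZero (fun i => K x i k) (n - 1)) ∧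
      ∀ m j k, pderiv (fun y => K y m j) k x - pderiv (fun y => K y m k) j x =
        -(m.val * (pderiv lam k x * extendZero (fun i => K x i j) (m.val - 1)
          - pderiv lam j x * extendZero (fun i => K x i k) (m.val - 1))) := by
  have hUx := hU.mem_nhds hx
  have hdet : ∀ y ∈ U, (K y).det ≠ 0 := fun y hy =>
    det_ne_zero_of_eq_smul (hG.nondegenerate y hy) (hGK y hy)
  have hu : IsUnit (K x).det := isUnit_iff_ne_zero.mpr (hdet x hx)
  have h1 : K x * (K x)⁻¹ = 1 := Matrix.mul_nonsing_inv _ hu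
  have h2 : (K x)⁻¹ * K x = 1 := Matrix.nonsing_inv_mul _ hu
  have hAd : EntriesDifferentiableAt A x := fun i j =>
    ((hA.smooth i j).contDiffAt hUx).differentiableAt (by simp)
  have hsymm : ∀ᶠ y in 𝓝 x, (G y).IsSymm := Filter.eventually_of_mem hUx hG.symm
  set c : Fin n → Fin n → ℝ := fun k i => K x i k with hc
  set ℓ : Fin n → ℝ := (fun j => pderiv lam j x) ᵥ* (K x)⁻¹ with hℓ
  -- The Levi-Civita connection form in the coframe `K`.
  set W : Fin n → Matrix (Fin n) (Fin n) ℝ := fun k =>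
    (K x * connectionMatrix G x k - matrixPderiv K k x) * (K x)⁻¹ with hWdef
  have hW : ∀ k, K x * connectionMatrix G x k = W k * K x + matrixPderiv K k x := fun k => by
    simp only [hWdef]
    rw [Matrix.mul_assoc, h2, Matrix.mul_one, sub_add_cancel]
  have hskew : ∀ k, (W k)ᵀ * reversal n + reversal n * W k = 0 := fun k =>
    (skew_of_metric hε (hdet x hx) (hGK x hx)
      (matrixPderiv_coframe_metric (hK x hx) (Filter.eventually_of_mem hUx hGK) k) (hW k)).mp
      (matrixPderiv_metric hsymm (hG.nondegenerate x hx) k)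
  have hbr : ∀ k, W k * jordanBlock n 0 - jordanBlock n 0 * W k + pderiv lam k x • 1
      = (1 / 2 : ℝ) • ((n : ℝ) • Matrix.vecMulVec (c k) ℓ
        + reversal n * ((n : ℝ) • Matrix.vecMulVec (c k) ℓ)ᵀ * reversal n) := fun k => by
    have hT := coframe_tensorDTrace (hlam x hx) (Filter.eventually_of_mem hUx hdet)
      (Filter.eventually_of_mem hUx hKA) k
    rw [← coframe_covPderiv (hK x hx) hAd (hlam x hx) (hdet x hx)
      (Filter.eventually_of_mem hUx hKA) (hW k), ← covDeriv_single, hA.covDeriv_eq x hx,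
      Matrix.mul_smul, Matrix.smul_mul, Matrix.mul_add, Matrix.add_mul,
      coframe_adjointWrt hε (hdet x hx) (hGK x hx), hT]
  have hℓ0 : ∀ i : Fin n, i.val + 1 < n → ℓ i = 0 := fun i hi =>
    vecMul_inv_eq_of_compatible (hdet x hx) (fun _ _ => rfl) hbr i hi
  set μ := extendZero ℓ (n - 1) with hμ
  have hℓμ : ∀ i : Fin n, ℓ i = if i.val + 1 = n then μ else 0 := fun i => by
    split_ifs with h
    · rw [hμ, ← extendZero_val ℓ i]
      congr 1
      omega
    · exact hℓ0 i (by omega)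
  have hdl : ∀ k, pderiv lam k x = μ * extendZero (c k) (n - 1) := fun k => by
    have e : ℓ ᵥ* K x = fun j => pderiv lam j x := by
      rw [hℓ, Matrix.vecMul_vecMul, h2, Matrix.vecMul_one]
    have hn : n - 1 < n := by have := k.pos; omega
    rw [← congrFun e k, Matrix.vecMul, dotProduct, Finset.sum_eq_single ⟨n - 1, hn⟩]
    · rw [hℓμ, if_pos (by simp; omega), extendZero, dif_pos hn]
    · intro l _ hl
      rw [hℓμ, if_neg, zero_mul]
      exact fun h => hl (Fin.ext (by simp; omega))
    · simp
  -- `W k` and `frameConnection` solve the same bracket equation and are both skew; their difference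
  -- commutes with the block, hence vanishes.
  have hWeq : ∀ k, W k = frameConnection μ (c k) := fun k => by
    have hb := hbr k
    rw [coframe_compatibility_rhs hℓμ, ← frameConnection_bracket, hdl k] at hb
    have hb' := add_right_cancel hb
    refine sub_eq_zero.mp (eq_zero_of_commute_of_skew ?_ ?_)
    · rw [Matrix.sub_mul, Matrix.mul_sub, ← sub_eq_zero]
      rw [← sub_eq_zero] at hb'
      rw [← hb']
      abel
    · have e1 := hskew k
      have e2 := frameConnection_skew μ (c k)
      rw [Matrix.transpose_sub, Matrix.sub_mul, Matrix.mul_sub, sub_add_sub_comm, e1, e2, sub_zero]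
  refine ⟨μ, hdl, fun m j k => ?_⟩
  -- Vanishing torsion, read in the coframe.
  have hcomm : (K x * connectionMatrix G x k) m j = (K x * connectionMatrix G x j) m k := by
    simp only [Matrix.mul_apply]
    exact Finset.sum_congr rfl fun i _ => by rw [connectionMatrix_comm hsymm]
  have hcol : ∀ k j, (W k * K x) m j = (frameConnection μ (c k) *ᵥ c j) m := fun k j => by
    rw [hWeq]
    rfl
  rw [hW, hW, Matrix.add_apply, Matrix.add_apply, hcol, hcol] at hcomm
  have ht := frameConnection_mulVec_sub μ (c k) (c j) m
  simp only [matrixPderiv, Matrix.of_apply] at hcomm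
  rw [hdl k, hdl j]
  linear_combination hcomm - ht

end FrameEquations

/-! ### Construction of the canonical coframe. -/

section CanonicalFrame

variable {n : ℕ}

/-- All entries of a matrix-valued function are smooth on `V`. -/
def SmoothEntriesOn (M : E n → Matrix (Fin n) (Fin n) ℝ) (V : Set (E n)) : Prop :=
  ∀ i j, ContDiffOn ℝ ∞ (fun y => M y i j) V

variable {V : Set (E n)} {M P : E n → Matrix (Fin n) (Fin n) ℝ}

theorem SmoothEntriesOn.mul (hM : SmoothEntriesOn M V) (hP : SmoothEntriesOn P V) :
    SmoothEntriesOn (fun y => M y * P y) V := fun i j => by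
  simp only [Matrix.mul_apply]
  exact ContDiffOn.sum fun l _ => (hM i l).mul (hP l j)

theorem smoothEntriesOn_const (B : Matrix (Fin n) (Fin n) ℝ) :
    SmoothEntriesOn (fun _ => B) V := fun _ _ => contDiffOn_const

theorem SmoothEntriesOn.pow (hM : SmoothEntriesOn M V) (k : ℕ) :
    SmoothEntriesOn (fun y => M y ^ k) V := by
  induction k with
  | zero => simpa using smoothEntriesOn_const 1
  | succ k ih => simpa only [pow_succ] using ih.mul hM

theorem SmoothEntriesOn.mono (hM : SmoothEntriesOn M V) {V' : Set (E n)} (h : V' ⊆ V) :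
    SmoothEntriesOn M V' := fun i j => (hM i j).mono h

theorem SmoothEntriesOn.entriesDifferentiableAt (hM : SmoothEntriesOn M V) (hV : IsOpen V)
    {x : E n} (hx : x ∈ V) : EntriesDifferentiableAt M x := fun i j =>
  ((hM i j).contDiffAt (hV.mem_nhds hx)).differentiableAt (by simp)

theorem SmoothEntriesOn.mulVec (hM : SmoothEntriesOn M V) {v : E n → Fin n → ℝ}
    (hv : ∀ i, ContDiffOn ℝ ∞ (fun y => v y i) V) (i : Fin n) :
    ContDiffOn ℝ ∞ (fun y => (M y *ᵥ v y) i) V := by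
  simp only [Matrix.mulVec, dotProduct]
  exact ContDiffOn.sum fun l _ => (hM i l).mul (hv l)

theorem SmoothEntriesOn.quadratic (hM : SmoothEntriesOn M V) {v : E n → Fin n → ℝ}
    (hv : ∀ i, ContDiffOn ℝ ∞ (fun y => v y i) V) :
    ContDiffOn ℝ ∞ (fun y => v y ⬝ᵥ M y *ᵥ v y) V := by
  have : ∀ y, v y ⬝ᵥ M y *ᵥ v y = ∑ i, v y i * (M y *ᵥ v y) i := fun y => rfl
  simp only [this]
  exact ContDiffOn.sum fun l _ => (hv l).mul (hM.mulVec hv l)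

theorem transpose_pow_mul_of_selfadjoint {G N : Matrix (Fin n) (Fin n) ℝ}
    (h : Nᵀ * G = G * N) (a : ℕ) : (N ^ a)ᵀ * G = G * N ^ a := by
  induction a with
  | zero => simp
  | succ a ih =>
    rw [pow_succ, Matrix.transpose_mul, Matrix.mul_assoc, ih, ← Matrix.mul_assoc, h,
      Matrix.mul_assoc, ← pow_succ', pow_succ]

theorem pow_mulVec_dotProduct {G N : Matrix (Fin n) (Fin n) ℝ} (h : Nᵀ * G = G * N)
    (a b : ℕ) (v w : Fin n → ℝ) :
    (N ^ a *ᵥ v) ⬝ᵥ (G * N ^ b) *ᵥ w = v ⬝ᵥ (G * N ^ (a + b)) *ᵥ w := by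
  rw [← Matrix.vecMul_transpose, ← Matrix.dotProduct_mulVec, Matrix.mulVec_mulVec,
    ← Matrix.mul_assoc, transpose_pow_mul_of_selfadjoint h, Matrix.mul_assoc, pow_add]

/-- Selfadjointness moves all powers of `N` to one side. Adding `c N^a v` thus changes the number
`g(v, N^j v)` only by those with exponents `j + a` and `j + 2a`, so for nilpotent `N` these numbers
can be corrected from the top exponent downwards. -/
theorem quadratic_add_smul_pow {G N : Matrix (Fin n) (Fin n) ℝ} (h : Nᵀ * G = G * N)
    (a j : ℕ) (c : ℝ) (v : Fin n → ℝ) :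
    (v + c • (N ^ a *ᵥ v)) ⬝ᵥ (G * N ^ j) *ᵥ (v + c • (N ^ a *ᵥ v))
      = v ⬝ᵥ (G * N ^ j) *ᵥ v + 2 * c * (v ⬝ᵥ (G * N ^ (j + a)) *ᵥ v)
        + c ^ 2 * (v ⬝ᵥ (G * N ^ (j + 2 * a)) *ᵥ v) := by
  have e1 : v ⬝ᵥ (G * N ^ j) *ᵥ (N ^ a *ᵥ v) = v ⬝ᵥ (G * N ^ (j + a)) *ᵥ v := by
    rw [Matrix.mulVec_mulVec, Matrix.mul_assoc, ← pow_add]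
  have e2 : (N ^ a *ᵥ v) ⬝ᵥ (G * N ^ j) *ᵥ v = v ⬝ᵥ (G * N ^ (j + a)) *ᵥ v := by
    rw [pow_mulVec_dotProduct h, add_comm]
  have e3 : (N ^ a *ᵥ v) ⬝ᵥ (G * N ^ j) *ᵥ (N ^ a *ᵥ v)
      = v ⬝ᵥ (G * N ^ (j + 2 * a)) *ᵥ v := by
    rw [pow_mulVec_dotProduct h, Matrix.mulVec_mulVec, Matrix.mul_assoc, ← pow_add]
    congr 4
    ring
  simp only [Matrix.mulVec_add, Matrix.mulVec_smul, add_dotProduct, dotProduct_add,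
    smul_dotProduct, dotProduct_smul, smul_eq_mul, e1, e2, e3]
  ring

/-- Polarisation: evaluating on `e_i` and on `e_i + e_j` recovers every entry of `B`. -/
theorem exists_quadratic_ne_zero {B : Matrix (Fin n) (Fin n) ℝ} (hsymm : B.IsSymm) (hB : B ≠ 0) :
    ∃ w : Fin n → ℝ, w ⬝ᵥ B *ᵥ w ≠ 0 := by
  by_contra! h
  refine hB ?_
  ext i j
  have hd : ∀ i, B i i = 0 := fun i => by simpa using h (Pi.single i 1)
  have := h (Pi.single i 1 + Pi.single j 1)
  simp only [Matrix.mulVec_add, add_dotProduct, dotProduct_add, Matrix.mulVec_single_one,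
    single_one_dotProduct, Matrix.col_apply, hd] at this
  have hs := hsymm.apply i j
  simp only [Matrix.zero_apply]
  linarith

/-- A smooth vector field, cyclic for the selfadjoint nilpotent field `N`, normalised so that
`g(v, N^j v)` vanishes for `j < n - 1` and is a sign for `j = n - 1`. -/
theorem exists_normalized_vector {U : Set (E n)} (hU : IsOpen U)
    {G N : E n → Matrix (Fin n) (Fin n) ℝ}
    (hG : IsMetricOn U G) (hN : SmoothEntriesOn N U)
    (hself : ∀ y ∈ U, (N y)ᵀ * G y = G y * N y) (hnil : ∀ y ∈ U, N y ^ n = 0) {p : E n}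
    (hp : p ∈ U) (hNp : N p ^ (n - 1) ≠ 0) :
    ∃ (V : Set (E n)) (ε : ℝ) (v : E n → Fin n → ℝ), IsOpen V ∧ V ⊆ U ∧ p ∈ V ∧
      (ε = 1 ∨ ε = -1) ∧ (∀ i, ContDiffOn ℝ ∞ (fun y => v y i) V) ∧
      ∀ y ∈ V, ∀ j, v y ⬝ᵥ (G y * N y ^ j) *ᵥ v y = if j + 1 = n then ε else 0 := by
  have hGN : ∀ j, SmoothEntriesOn (fun y => G y * N y ^ j) U := fun j =>
    SmoothEntriesOn.mul hG.smooth (hN.pow j)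
  have hn : 0 < n := by
    rcases Nat.eq_zero_or_pos n with h | h
    · subst h
      exact absurd (Subsingleton.elim _ _) hNp
    · exact h
  obtain ⟨w, hw⟩ : ∃ w : Fin n → ℝ, w ⬝ᵥ (G p * N p ^ (n - 1)) *ᵥ w ≠ 0 := by
    refine exists_quadratic_ne_zero ?_ fun h => hNp ?_
    · rw [Matrix.IsSymm, Matrix.transpose_mul, (hG.symm p hp).eq,
        transpose_pow_mul_of_selfadjoint (hself p hp)]
    · have hu : IsUnit (G p).det := isUnit_iff_ne_zero.mpr (hG.nondegenerate p hp)
      have := congrArg (fun B => (G p)⁻¹ * B) h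
      simpa [← Matrix.mul_assoc, Matrix.nonsing_inv_mul _ hu] using this
  set q : E n → ℝ := fun y => w ⬝ᵥ (G y * N y ^ (n - 1)) *ᵥ w with hq
  have hqs : ContDiffOn ℝ ∞ q U := (hGN (n - 1)).quadratic fun i => contDiffOn_const
  obtain ⟨ε, hε, hεq⟩ : ∃ ε : ℝ, (ε = 1 ∨ ε = -1) ∧ 0 < ε * q p := by
    rcases lt_or_gt_of_ne hw with h | h
    · exact ⟨-1, Or.inr rfl, by simpa using h⟩
    · exact ⟨1, Or.inl rfl, by simpa using h⟩
  have hεε : ε * ε = 1 := by rcases hε with h | h <;> simp [h]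
  -- The constant vector `w` keeps the sign of `g(w, N^{n-1} w)` on this neighbourhood, so the
  -- square root used for rescaling stays smooth there.
  set V : Set (E n) := U ∩ {y | 0 < ε * q y} with hV
  have hVopen : IsOpen V :=
    (continuousOn_const.mul hqs.continuousOn).isOpen_inter_preimage hU isOpen_Ioi
  have hVU : V ⊆ U := Set.inter_subset_left
  -- After stage `m` the values `g(v, N^j v)` are correct for all `j ≥ n - 1 - m`.
  have key : ∀ m, m + 1 ≤ n → ∃ v : E n → Fin n → ℝ,
      (∀ i, ContDiffOn ℝ ∞ (fun y => v y i) V) ∧ ∀ y ∈ V, ∀ j, n ≤ j + m + 1 →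
        v y ⬝ᵥ (G y * N y ^ j) *ᵥ v y = if j + 1 = n then ε else 0 := by
    have hbig : ∀ y ∈ V, ∀ j, n ≤ j → ∀ v : Fin n → ℝ, v ⬝ᵥ (G y * N y ^ j) *ᵥ v = 0 := by
      intro y hy j hj v
      rw [pow_eq_zero_of_le hj (hnil y (hVU hy))]
      simp
    intro m
    induction m with
    | zero =>
      intro _
      refine ⟨fun y => (1 / Real.sqrt (ε * q y)) • w, fun i => ?_, fun y hy j hj => ?_⟩
      · simp only [Pi.smul_apply, smul_eq_mul]
        refine (contDiffOn_const.div ((contDiffOn_const.mul (hqs.mono hVU)).sqrt fun y hy => ?_)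
          fun y hy => ?_).mul contDiffOn_const
        · exact hy.2.ne'
        · exact (Real.sqrt_pos.mpr hy.2).ne'
      · by_cases hj' : j + 1 = n
        · have hj1 : j = n - 1 := by omega
          have hpos : 0 < ε * q y := hy.2
          have hs := Real.mul_self_sqrt hpos.le
          have hs0 := (Real.sqrt_pos.mpr hpos).ne'
          rw [if_pos hj', hj1, Matrix.mulVec_smul, smul_dotProduct, dotProduct_smul]
          change (1 / √(ε * q y)) * ((1 / √(ε * q y)) * q y) = ε
          field_simp
          rw [pow_two, hs, ← mul_assoc, hεε, one_mul]
        · rw [if_neg hj']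
          exact hbig y hy j (by omega) _
    | succ m ih =>
      intro hm
      obtain ⟨v, hv, hvq⟩ := ih (by omega)
      set f : E n → ℝ := fun y => v y ⬝ᵥ (G y * N y ^ (n - 2 - m)) *ᵥ v y with hf
      have hfs : ContDiffOn ℝ ∞ f V := ((hGN _).mono hVU).quadratic hv
      -- The coefficient solves `f + 2 c ε = 0`, using `ε² = 1`. This kills `g(v, N^{n-2-m} v)`,
      -- while higher exponents are unaffected because `N^n = 0`.
      refine ⟨fun y => v y + (-(ε / 2) * f y) • (N y ^ (m + 1) *ᵥ v y), fun i => ?_,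
        fun y hy j hj => ?_⟩
      · simp only [Pi.add_apply, Pi.smul_apply, smul_eq_mul]
        exact (hv i).add ((contDiffOn_const.mul hfs).mul (((hN.mono hVU).pow _).mulVec hv i))
      · rw [quadratic_add_smul_pow (hself y (hVU hy)), hbig y hy (j + 2 * (m + 1)) (by omega)]
        by_cases hjm : j = n - 2 - m
        · have hv1 := hvq y hy (j + (m + 1)) (by omega)
          rw [if_pos (by omega)] at hv1
          rw [hv1, if_neg (by omega), hjm]
          change f y + _ + _ = 0
          linear_combination -f y * hεε
        · rw [hbig y hy (j + (m + 1)) (by omega), hvq y hy j (by omega)]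
          ring
  obtain ⟨v, hv, hvq⟩ := key (n - 1) (by omega)
  exact ⟨V, ε, v, hVopen, hVU, ⟨hp, hεq⟩, hε, hv, fun y hy j => hvq y hy j (by omega)⟩

/-- The canonical coframe of a metric and a selfadjoint Jordan block. -/
theorem exists_canonical_coframe {U : Set (E n)} (hU : IsOpen U)
    {G A : E n → Matrix (Fin n) (Fin n) ℝ} {lam : E n → ℝ}
    (hG : IsMetricOn U G) (hA : SmoothEntriesOn A U) (hlam : ContDiffOn ℝ ∞ lam U)
    (hself : ∀ y ∈ U, (A y)ᵀ * G y = G y * A y) (hnil : ∀ y ∈ U, (A y - lam y • 1) ^ n = 0)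
    {p : E n} (hp : p ∈ U) (hAp : (A p - lam p • 1) ^ (n - 1) ≠ 0) :
    ∃ (V : Set (E n)) (ε : ℝ) (K : E n → Matrix (Fin n) (Fin n) ℝ), IsOpen V ∧ V ⊆ U ∧ p ∈ V ∧
      (ε = 1 ∨ ε = -1) ∧ SmoothEntriesOn K V ∧
      (∀ y ∈ V, G y = ε • ((K y)ᵀ * reversal n * K y)) ∧
      ∀ y ∈ V, K y * A y = jordanBlock n (lam y) * K y := by
  set N : E n → Matrix (Fin n) (Fin n) ℝ := fun y => A y - lam y • 1 with hNdef
  have hN : SmoothEntriesOn N U := fun i j => by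
    simp only [hNdef, Matrix.sub_apply, Matrix.smul_apply, smul_eq_mul]
    exact (hA i j).sub (hlam.mul contDiffOn_const)
  have hNself : ∀ y ∈ U, (N y)ᵀ * G y = G y * N y := fun y hy => by
    simp [hNdef, Matrix.sub_mul, Matrix.mul_sub, hself y hy]
  obtain ⟨V, ε, v, hVo, hVU, hpV, hε, hv, hq⟩ :=
    exists_normalized_vector hU hG hN hNself hnil hp hAp
  have hεε : ε * ε = 1 := by rcases hε with h | h <;> simp [h]
  -- The powers decrease along the columns so that `N` sends each column to the preceding one, as
  -- for a block with ones above the diagonal.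
  set F : E n → Matrix (Fin n) (Fin n) ℝ := fun y =>
    Matrix.of fun k i => (N y ^ (n - 1 - i.val) *ᵥ v y) k with hF
  have hFs : SmoothEntriesOn F V := fun k i => ((hN.mono hVU).pow _).mulVec hv k
  have hGram : ∀ y ∈ V, (F y)ᵀ * G y * F y = ε • reversal n := fun y hy => by
    ext i j
    have e : ((F y)ᵀ * G y * F y) i j
        = (N y ^ (n - 1 - i.val) *ᵥ v y) ⬝ᵥ (G y *ᵥ (N y ^ (n - 1 - j.val) *ᵥ v y)) := by
      rw [Matrix.mul_assoc, Matrix.mul_apply]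
      rfl
    rw [e, Matrix.mulVec_mulVec, pow_mulVec_dotProduct (hNself y (hVU hy)), hq y hy]
    simp only [reversal, Matrix.smul_apply, Matrix.of_apply, smul_eq_mul, mul_ite, mul_one,
      mul_zero]
    exact if_congr (by omega) rfl rfl
  have hNF : ∀ y ∈ V, N y * F y = F y * jordanBlock n 0 := fun y hy => by
    ext k i
    have e : (N y * F y) k i = (N y *ᵥ (N y ^ (n - 1 - i.val) *ᵥ v y)) k := rfl
    rw [e, Matrix.mulVec_mulVec, ← pow_succ', mul_jordanBlock_zero_apply]
    split_ifs with h
    · simp only [hF, Matrix.of_apply]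
      congr 4
      omega
    · have : n - 1 - i.val + 1 = n := by omega
      rw [this, hnil y (hVU hy)]
      simp
  -- This is the inverse of `F`: the Gram matrix of the frame is `ε R`, and `R² = 1`, `ε² = 1` for
  -- `R = reversal n`.
  set K : E n → Matrix (Fin n) (Fin n) ℝ := fun y =>
    (ε • reversal n) * ((F y)ᵀ * G y) with hK
  have hKs : SmoothEntriesOn K V :=
    (smoothEntriesOn_const _).mul (SmoothEntriesOn.mul (fun i j => hFs j i)
      (SmoothEntriesOn.mono hG.smooth hVU))
  have hKF : ∀ y ∈ V, K y * F y = 1 := fun y hy => by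
    simp only [hK]
    rw [Matrix.mul_assoc, hGram y hy, Matrix.smul_mul, Matrix.mul_smul, smul_smul, hεε,
      reversal_mul_self, one_smul]
  have hFK : ∀ y ∈ V, F y * K y = 1 := fun y hy => mul_eq_one_comm.mp (hKF y hy)
  refine ⟨V, ε, K, hVo, hVU, hpV, hε, hKs, fun y hy => ?_, fun y hy => ?_⟩
  · have hKt : (K y)ᵀ = G y * F y * (ε • reversal n) := by
      simp only [hK]
      rw [Matrix.transpose_mul, Matrix.transpose_mul, Matrix.transpose_transpose,
        (hG.symm y (hVU hy)).eq, Matrix.transpose_smul, reversal_transpose]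
    rw [hKt, Matrix.mul_assoc _ _ (reversal n), Matrix.smul_mul, reversal_mul_self,
      Matrix.mul_smul, Matrix.mul_one, Matrix.smul_mul, smul_smul, hεε, one_smul,
      Matrix.mul_assoc, hFK y hy, Matrix.mul_one]
  · have hAF : A y * F y = F y * jordanBlock n (lam y) := by
      have : A y = lam y • 1 + N y := by simp [hNdef]
      rw [this, Matrix.add_mul, hNF y hy, jordanBlock_eq (lam y), Matrix.mul_add]
      simp
    clear_value K
    calc K y * A y = K y * (A y * F y) * K y := by
          rw [Matrix.mul_assoc, Matrix.mul_assoc, hFK y hy, Matrix.mul_one]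
      _ = jordanBlock n (lam y) * K y := by
        rw [hAF, ← Matrix.mul_assoc, hKF y hy, Matrix.one_mul]

end CanonicalFrame

/-! ### Poincaré lemma, integration of the structure equations, inverse functions. -/

section Coordinates

variable {n : ℕ}

theorem contDiffOn_pderiv {f : E n → ℝ} {B : Set (E n)} (hB : IsOpen B)
    (hf : ContDiffOn ℝ ∞ f B) (k : Fin n) : ContDiffOn ℝ ∞ (fun y => pderiv f k y) B := by
  simp only [pderiv]
  exact (hf.fderiv_of_isOpen hB (by simp)).clm_apply contDiffOn_const

theorem pderiv_pderiv_comm {f : E n → ℝ} {x : E n} (hf : ContDiffAt ℝ ∞ f x) (j k : Fin n) :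
    pderiv (fun y => pderiv f j y) k x = pderiv (fun y => pderiv f k y) j x := by
  have hs : IsSymmSndFDerivAt ℝ f x := hf.isSymmSndFDerivAt (by
    rw [minSmoothness_of_isRCLikeNormedField]; exact ENat.LEInfty.out)
  have hd : DifferentiableAt ℝ (fderiv ℝ f) x :=
    (hf.fderiv_right (m := 1) (by norm_cast)).differentiableAt (by simp)
  have key : ∀ j k, pderiv (fun y => pderiv f j y) k x
      = fderiv ℝ (fderiv ℝ f) x (EuclideanSpace.single k 1) (EuclideanSpace.single j 1) := by
    intro j k
    have := (hd.hasFDerivAt.clm_apply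
      (hasFDerivAt_const (EuclideanSpace.single j (1 : ℝ) : E n) x)).fderiv
    simp only [pderiv, this]
    simp
  rw [key, key, hs.eq]

/-- The Poincaré lemma for a smooth closed `1`-form on a convex open set, in coordinates. -/
theorem exists_pderiv_eq_of_closed {B : Set (E n)} (hB : IsOpen B) (hconv : Convex ℝ B)
    {w : Fin n → E n → ℝ} (hw : ∀ j, ContDiffOn ℝ ∞ (w j) B)
    (hclosed : ∀ y ∈ B, ∀ j k, pderiv (w j) k y = pderiv (w k) j y) (p : E n) :
    ∃ f : E n → ℝ, ContDiffOn ℝ ∞ f B ∧ f p = 0 ∧ ∀ y ∈ B, ∀ k, pderiv f k y = w k y := by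
  set W : E n → E n →L[ℝ] ℝ := fun y => ∑ j, w j y • (EuclideanSpace.proj j : E n →L[ℝ] ℝ) with hW
  have hWs : ContDiffOn ℝ ∞ W B := ContDiffOn.sum fun j _ => (hw j).smul contDiffOn_const
  have hWd : ∀ y ∈ B, ∀ u v : E n, fderiv ℝ W y u v
      = ∑ j, ∑ k, u k * v j * pderiv (w j) k y := by
    intro y hy u v
    have hwd : ∀ j, DifferentiableAt ℝ (w j) y := fun j =>
      ((hw j).contDiffAt (hB.mem_nhds hy)).differentiableAt (by simp)
    have h : HasFDerivAt W (∑ j, (fderiv ℝ (w j) y).smulRight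
        (EuclideanSpace.proj j : E n →L[ℝ] ℝ)) y :=
      HasFDerivAt.fun_sum fun j _ => by
        have := (hwd j).hasFDerivAt.smul_const (EuclideanSpace.proj j : E n →L[ℝ] ℝ)
        exact this
    rw [h.fderiv]
    simp only [sum_apply, ContinuousLinearMap.smulRight_apply,
      smul_apply, PiLp.proj_apply, smul_eq_mul,
      fderiv_eq_sum_pderiv (w _) y u, Finset.sum_mul]
    exact Finset.sum_congr rfl fun j _ => Finset.sum_congr rfl fun k _ => by ring
  obtain ⟨f, hf⟩ := hconv.exists_forall_hasFDerivAt_of_fderiv_symmetric hB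
    (hWs.differentiableOn (by simp)) fun y hy u v => by
      rw [hWd y hy, hWd y hy, Finset.sum_comm]
      refine Finset.sum_congr rfl fun j _ => Finset.sum_congr rfl fun k _ => ?_
      rw [hclosed y hy k j]
      ring
  have hf' : ∀ y ∈ B, HasFDerivAt (fun z => f z - f p) (W y) y := fun y hy =>
    (hf y hy).sub_const _
  refine ⟨fun z => f z - f p, ?_, sub_self _, fun y hy k => ?_⟩
  · rw [contDiffOn_infty_iff_fderiv_of_isOpen hB]
    exact ⟨fun y hy => (hf' y hy).differentiableAt.differentiableWithinAt,
      hWs.congr fun y hy => (hf' y hy).fderiv⟩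
  · rw [pderiv, (hf' y hy).fderiv]
    simp [hW]

/-- Successive integration of the structure equations gives coordinate functions. -/
theorem exists_coordinate_functions {B : Set (E n)} (hB : IsOpen B) (hconv : Convex ℝ B)
    {K : E n → Matrix (Fin n) (Fin n) ℝ} {lam : E n → ℝ} (hK : SmoothEntriesOn K B)
    (hlam : ContDiffOn ℝ ∞ lam B)
    (hstr : ∀ y ∈ B, ∀ m j k, pderiv (fun z => K z m j) k y - pderiv (fun z => K z m k) j y =
        -(m.val * (pderiv lam k y * extendZero (fun i => K y i j) (m.val - 1)
          - pderiv lam j y * extendZero (fun i => K y i k) (m.val - 1)))) (p : E n) (m : ℕ) :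
    ∃ X : ℕ → E n → ℝ, ∀ i : Fin n, i.val < m → ContDiffOn ℝ ∞ (X i.val) B ∧ X i.val p = 0 ∧
      ∀ y ∈ B, ∀ k, pderiv (X i.val) k y
        = K y i k - i.val * X (i.val - 1) y * pderiv lam k y := by
  induction m with
  | zero => exact ⟨fun _ _ => 0, fun i hi => absurd hi (Nat.not_lt_zero _)⟩
  | succ m ih =>
    obtain ⟨X, hX⟩ := ih
    by_cases hm : m < n
    swap
    · exact ⟨X, fun i hi => hX i (by omega)⟩
    have hprev : ∀ hm0 : 0 < m, ContDiffOn ℝ ∞ (X (m - 1)) B := fun hm0 =>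
      (hX ⟨m - 1, by omega⟩ (by simp; omega)).1
    have hXs : ContDiffOn ℝ ∞ (fun y => (m : ℝ) * X (m - 1) y) B := by
      rcases Nat.eq_zero_or_pos m with h0 | h0
      · simpa [h0] using contDiffOn_const
      · exact contDiffOn_const.mul (hprev h0)
    -- The form `θ^m - m X_{m-1} dλ`. For `m = 0` the index `m - 1` truncates, but the factor `m`
    -- removes the term.
    set w : Fin n → E n → ℝ := fun k y =>
      K y ⟨m, hm⟩ k + -1 * ((m : ℝ) * X (m - 1) y * pderiv lam k y) with hw
    have hws : ∀ k, ContDiffOn ℝ ∞ (w k) B := fun k =>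
      (hK _ _).add (contDiffOn_const.mul (hXs.mul (contDiffOn_pderiv hB hlam k)))
    have hclosed : ∀ y ∈ B, ∀ j k, pderiv (w j) k y = pderiv (w k) j y := by
      intro y hy j k
      have hBy := hB.mem_nhds hy
      have d1 : ∀ j, DifferentiableAt ℝ (fun z => K z ⟨m, hm⟩ j) y := fun j =>
        ((hK _ j).contDiffAt hBy).differentiableAt (by simp)
      have d2 : DifferentiableAt ℝ (fun y => (m : ℝ) * X (m - 1) y) y :=
        (hXs.contDiffAt hBy).differentiableAt (by simp)
      have d3 : ∀ j, DifferentiableAt ℝ (fun y => pderiv lam j y) y := fun j =>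
        ((contDiffOn_pderiv hB hlam j).contDiffAt hBy).differentiableAt (by simp)
      have hexp : ∀ j k, pderiv (w j) k y = pderiv (fun z => K z ⟨m, hm⟩ j) k y
          + -1 * (pderiv (fun y => (m : ℝ) * X (m - 1) y) k y * pderiv lam j y
            + m * X (m - 1) y * pderiv (fun y => pderiv lam j y) k y) := fun j k => by
        simp only [hw]
        rw [pderiv_add (d1 j) ((d2.fun_mul (d3 j)).const_mul _),
          pderiv_const_mul _ (d2.fun_mul (d3 j)), pderiv_mul d2 (d3 j)]
      have hX' : ∀ k, pderiv (fun y => (m : ℝ) * X (m - 1) y) k y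
          = m * (extendZero (fun i => K y i k) (m - 1)
            - (m - 1 : ℕ) * X (m - 1 - 1) y * pderiv lam k y) := fun k => by
        rcases Nat.eq_zero_or_pos m with h0 | h0
        · simp [h0, pderiv_const]
        · rw [pderiv_const_mul _ (((hprev h0).contDiffAt hBy).differentiableAt (by simp)),
            (hX ⟨m - 1, by omega⟩ (by simp; omega)).2.2 y hy k, extendZero, dif_pos (by omega)]
      have hs := hstr y hy ⟨m, hm⟩ j k
      simp only at hs
      rw [hexp, hexp, hX', hX', pderiv_pderiv_comm (hlam.contDiffAt hBy) j k]
      -- The second derivatives of `λ` and the `dλ ∧ dλ` contributions cancel by symmetry; what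
      -- remains is the structure equation.
      linear_combination hs
    obtain ⟨f, hfs, hfp, hfd⟩ := exists_pderiv_eq_of_closed hB hconv hws hclosed p
    refine ⟨Function.update X m f, fun i hi => ?_⟩
    have hne : ¬ (i.val - 1 = m) ∨ i.val = 0 := by omega
    have hpv : ∀ y, (i.val : ℝ) * Function.update X m f (i.val - 1) y
        = i.val * X (i.val - 1) y := fun y => by
      rcases hne with h | h
      · rw [Function.update_of_ne h]
      · simp [h]
    simp only [hpv]
    by_cases him : i.val = m
    · have hi' : i = ⟨m, hm⟩ := Fin.ext him
      subst hi'
      simp only [Function.update_self]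
      refine ⟨hfs, hfp, fun y hy k => ?_⟩
      rw [hfd y hy k]
      simp only [hw]
      ring
    · rw [Function.update_of_ne him]
      exact hX i (by omega)

/-- The Jacobian matrix. -/
def jacobian (f : E n → E n) (x : E n) : Matrix (Fin n) (Fin n) ℝ :=
  Matrix.of fun i k => fderiv ℝ f x (EuclideanSpace.single k 1) i

theorem jacobian_apply {f : E n → E n} {x : E n} (hf : DifferentiableAt ℝ f x) (i k : Fin n) :
    jacobian f x i k = pderiv (fun y => f y i) k x := by
  have h := ((EuclideanSpace.proj i : E n →L[ℝ] ℝ).hasFDerivAt (x := f x)).comp x hf.hasFDerivAt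
  have h' : HasFDerivAt (fun y => f y i)
      ((EuclideanSpace.proj i : E n →L[ℝ] ℝ).comp (fderiv ℝ f x)) x := h
  simp [jacobian, pderiv, h'.fderiv]

theorem fderiv_apply_eq_jacobian_mulVec (f : E n → E n) (x u : E n) (i : Fin n) :
    fderiv ℝ f x u i = (jacobian f x *ᵥ u.ofLp) i := by
  have hu : u = ∑ k, u k • EuclideanSpace.single k (1 : ℝ) := by
    ext i
    simp [Pi.single_apply]
  conv_lhs => rw [hu]
  simp [jacobian, Matrix.mulVec, dotProduct, mul_comm]

theorem exists_fderiv_equiv {f : E n → E n} {x : E n} (h : (jacobian f x).det ≠ 0) :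
    ∃ e : E n ≃L[ℝ] E n, (e : E n →L[ℝ] E n) = fderiv ℝ f x := by
  have hinj : Function.Injective (fderiv ℝ f x : E n →ₗ[ℝ] E n) := by
    rw [injective_iff_map_eq_zero]
    intro u hu
    have h0 : jacobian f x *ᵥ u.ofLp = 0 := by
      ext i
      rw [← fderiv_apply_eq_jacobian_mulVec]
      exact congrArg (fun v : E n => v i) hu
    have := Matrix.eq_zero_of_mulVec_eq_zero h h0
    ext i
    exact congrFun this i
  refine ⟨(LinearEquiv.ofInjectiveEndo _ hinj).toContinuousLinearEquiv, ?_⟩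
  ext u i
  rfl

/-- The inverse function theorem with smooth inverse on the whole target. -/
theorem exists_smooth_openPartialHomeomorph {B : Set (E n)} (hB : IsOpen B) {f : E n → E n}
    (hf : ContDiffOn ℝ ∞ f B) (hdet : ∀ y ∈ B, (jacobian f y).det ≠ 0) {p : E n} (hp : p ∈ B) :
    ∃ ψ : OpenPartialHomeomorph (E n) (E n), (ψ : E n → E n) = f ∧ p ∈ ψ.source ∧ ψ.source ⊆ B ∧
      ContDiffOn ℝ ∞ ψ.symm ψ.target := by
  have hfa : ∀ y ∈ B, ContDiffAt ℝ ∞ f y := fun y hy => hf.contDiffAt (hB.mem_nhds hy)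
  have hfd : ∀ y ∈ B, ∃ e : E n ≃L[ℝ] E n, HasFDerivAt f (e : E n →L[ℝ] E n) y := fun y hy => by
    obtain ⟨e, he⟩ := exists_fderiv_equiv (hdet y hy)
    exact ⟨e, he ▸ ((hfa y hy).differentiableAt (by simp)).hasFDerivAt⟩
  obtain ⟨e, he⟩ := hfd p hp
  set ψ₀ := (hfa p hp).toOpenPartialHomeomorph f he (by simp) with hψ₀
  have hcoe : (ψ₀ : E n → E n) = f := rfl
  refine ⟨ψ₀.restrOpen B hB, hcoe, ⟨(hfa p hp).mem_toOpenPartialHomeomorph_source he (by simp), hp⟩,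
    fun y hy => hy.2, fun y hy => ?_⟩
  -- The derivative is invertible throughout `B`, so the inverse is smooth at every point of the
  -- target and not only at the image of `p`.
  have hys : (ψ₀.restrOpen B hB).symm y ∈ B := ((ψ₀.restrOpen B hB).map_target hy).2
  obtain ⟨e', he'⟩ := hfd _ hys
  exact ((ψ₀.restrOpen B hB).contDiffAt_symm hy he' (hfa _ hys)).contDiffWithinAt

end Coordinates

/-! ### Normal coordinates for a coframe satisfying the structure equations. -/

section NormalCoframe

variable {n : ℕ}

/-- The coframe in which the normal forms of the metric and of the `(1,1)`-tensor are the
antidiagonal form and a Jordan block. -/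
def normalCoframe (lam : ℝ → ℝ) (x : E n) : Matrix (Fin n) (Fin n) ℝ :=
  Matrix.of fun i j => (if i = j then 1 else 0) +
    if j.val + 1 = n then i.val * deriv lam (coord x n) * coord x i.val else 0

/-- The index of the last coordinate. -/
def lastIndex (hn : 0 < n) : Fin n := ⟨n - 1, by omega⟩

theorem coord_eq_lastIndex (hn : 0 < n) (x : E n) : coord x n = x (lastIndex hn) := by
  rw [coord, dif_pos ⟨hn, le_rfl⟩]
  rfl

theorem normalCoframe_mul_apply (hn : 0 < n) (lam : ℝ → ℝ) (x : E n)
    (D : Matrix (Fin n) (Fin n) ℝ) (i k : Fin n) :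
    (normalCoframe lam x * D) i k
      = D i k + i.val * deriv lam (coord x n) * coord x i.val * D (lastIndex hn) k := by
  have h : ∀ j : Fin n, (j.val + 1 = n) ↔ j = lastIndex hn := fun j => by
    rw [Fin.ext_iff, lastIndex]
    simp only
    omega
  rw [Matrix.mul_apply]
  simp only [normalCoframe, Matrix.of_apply, h, add_mul, ite_mul, one_mul, zero_mul,
    Finset.sum_add_distrib, Finset.sum_ite_eq, Finset.sum_ite_eq', Finset.mem_univ, if_true]

/-- Multiplication by a bump function equal to `1` on `|t| ≤ r/3` and `0` for `|t| ≥ r/2`. It turns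
the eigenvalue, at first a function on an interval, into one that is smooth on all of `ℝ`. -/
theorem exists_smooth_extension {f : ℝ → ℝ} {r : ℝ} (hr : 0 < r)
    (hf : ContDiffOn ℝ ∞ f (Set.Ioo (-r) r)) :
    ∃ F : ℝ → ℝ, ContDiff ℝ ∞ F ∧ ∀ t, |t| < r / 3 → F t = f t := by
  let b : ContDiffBump (0 : ℝ) := ⟨r / 3, r / 2, by positivity, by linarith⟩
  refine ⟨fun t => b t * f t, contDiff_iff_contDiffAt.mpr fun t => ?_, fun t ht => ?_⟩
  · by_cases ht : t ∈ Set.Ioo (-r) r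
    · exact b.contDiffAt.mul (hf.contDiffAt (isOpen_Ioo.mem_nhds ht))
    · have hopen : IsOpen {s : ℝ | r / 2 < |s|} := isOpen_lt continuous_const continuous_abs
      have hmem : t ∈ {s : ℝ | r / 2 < |s|} := by
        by_contra h
        have h' : |t| ≤ r / 2 := not_lt.mp h
        have := abs_le.mp h'
        exact ht ⟨by linarith, by linarith⟩
      have : (fun s => b s * f s) =ᶠ[𝓝 t] fun _ => 0 := by
        filter_upwards [hopen.mem_nhds hmem] with s hs
        rw [b.zero_of_le_dist (by simpa using le_of_lt hs), zero_mul]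
      exact contDiffAt_const.congr_of_eventuallyEq this
  · simp only [b.one_of_mem_closedBall (x := t) (by simpa using ht.le), one_mul]

/-- A function on a ball whose differential annihilates the vectors with vanishing last
coordinate depends on the last coordinate only. -/
theorem eq_of_fderiv_eq_zero_of_last (hn : 0 < n) {h : E n → ℝ} {r : ℝ}
    (hd : ∀ y ∈ Metric.ball (0 : E n) r, DifferentiableAt ℝ h y)
    (hz : ∀ y ∈ Metric.ball (0 : E n) r, ∀ u : E n, u (lastIndex hn) = 0 → fderiv ℝ h y u = 0)
    {y : E n} (hy : y ∈ Metric.ball (0 : E n) r) :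
    EuclideanSpace.single (lastIndex hn) (y (lastIndex hn)) ∈ Metric.ball (0 : E n) r ∧
      h y = h (EuclideanSpace.single (lastIndex hn) (y (lastIndex hn))) := by
  -- The projection of `y` to the last axis. The segment from `a` to `y` stays in the ball, and its
  -- direction has vanishing last coordinate.
  set a : E n := EuclideanSpace.single (lastIndex hn) (y (lastIndex hn)) with ha
  have hab : a ∈ Metric.ball (0 : E n) r := by
    rw [mem_ball_zero_iff] at hy ⊢
    refine lt_of_le_of_lt ?_ hy
    rw [ha, PiLp.norm_single]
    exact PiLp.norm_apply_le y _
  refine ⟨hab, ?_⟩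
  have hmem : ∀ t ∈ Set.Icc (0 : ℝ) 1, a + t • (y - a) ∈ Metric.ball (0 : E n) r := fun t ht =>
    (convex_ball _ _).add_smul_sub_mem hab hy ht
  have hderiv : ∀ t ∈ Set.Icc (0 : ℝ) 1, HasDerivAt (fun t : ℝ => h (a + t • (y - a))) 0 t := by
    intro t ht
    have h1 : HasDerivAt (fun t : ℝ => a + t • (y - a)) (y - a) t := by
      simpa using ((hasDerivAt_id t).smul_const (y - a)).const_add a
    have h2 := (hd _ (hmem t ht)).hasFDerivAt.comp_hasDerivAt t h1
    rwa [hz _ (hmem t ht) _ (by simp [ha])] at h2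
  have := constant_of_has_deriv_right_zero (f := fun t : ℝ => h (a + t • (y - a))) (a := 0) (b := 1)
    (fun t ht => (hderiv t ht).continuousAt.continuousWithinAt)
    (fun t ht => (hderiv t ⟨ht.1, ht.2.le⟩).hasDerivWithinAt) 1 ⟨zero_le_one, le_rfl⟩
  simpa using this

/-- Coordinates in which a coframe satisfying the structure equations takes its normal form. -/
theorem exists_normal_coordinates (hn : 0 < n) {B : Set (E n)} (hB : IsOpen B)
    (hconv : Convex ℝ B) {K : E n → Matrix (Fin n) (Fin n) ℝ} {lam : E n → ℝ}
    (hK : SmoothEntriesOn K B) (hlam : ContDiffOn ℝ ∞ lam B) (hdet : ∀ y ∈ B, (K y).det ≠ 0)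
    (hdl : ∀ y ∈ B, ∃ μ : ℝ, ∀ k, pderiv lam k y = μ * extendZero (fun i => K y i k) (n - 1))
    (hstr : ∀ y ∈ B, ∀ m j k, pderiv (fun z => K z m j) k y - pderiv (fun z => K z m k) j y =
        -(m.val * (pderiv lam k y * extendZero (fun i => K y i j) (m.val - 1)
          - pderiv lam j y * extendZero (fun i => K y i k) (m.val - 1)))) {p : E n} (hp : p ∈ B) :
    ∃ (ψ : OpenPartialHomeomorph (E n) (E n)) (F : ℝ → ℝ), p ∈ ψ.source ∧ ψ.source ⊆ B ∧
      ContDiffOn ℝ ∞ ψ ψ.source ∧ ContDiffOn ℝ ∞ ψ.symm ψ.target ∧ ContDiff ℝ ∞ F ∧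
      (∀ y ∈ ψ.source, lam y = F (coord (ψ y) n)) ∧
      ∀ y ∈ ψ.source, K y = normalCoframe F (ψ y) * jacobian ψ y := by
  obtain ⟨X, hX⟩ := exists_coordinate_functions hB hconv hK hlam hstr p n
  set f : E n → E n := fun y => WithLp.toLp 2 fun i => X i.val y with hf
  have hfs : ContDiffOn ℝ ∞ f B := contDiffOn_euclidean.mpr fun i => (hX i i.isLt).1
  have hfd : ∀ y ∈ B, DifferentiableAt ℝ f y := fun y hy =>
    (hfs.contDiffAt (hB.mem_nhds hy)).differentiableAt (by simp)
  have hjac : ∀ y ∈ B, ∀ i k, jacobian f y i k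
      = K y i k - i.val * X (i.val - 1) y * pderiv lam k y := fun y hy i k => by
    rw [jacobian_apply (hfd y hy)]
    exact (hX i i.isLt).2.2 y hy k
  have hfp : f p = 0 := by
    ext i
    exact (hX i i.isLt).2.1
  -- All coordinate functions vanish at `p`, so the correction terms `m X_{m-1} dλ` do too, and
  -- invertibility of `K p` passes to the Jacobian.
  have hjp : jacobian f p = K p := by
    ext i k
    rw [hjac p hp]
    rcases Nat.eq_zero_or_pos i.val with h | h
    · simp [h]
    · have := (hX ⟨i.val - 1, by omega⟩ (by simp; omega)).2.1
      simp only at this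
      rw [this]
      ring
  have hjs : SmoothEntriesOn (fun y => jacobian f y) B := fun i k =>
    (contDiffOn_pderiv hB (hX i i.isLt).1 k).congr fun y hy => jacobian_apply (hfd y hy) i k
  have hdets : ContinuousOn (fun y => (jacobian f y).det) B := by
    simp only [Matrix.det_apply]
    exact continuousOn_finsetSum _ fun σ _ =>
      (continuousOn_finsetProd _ fun i _ => (hjs _ _).continuousOn).const_smul _
  set B' : Set (E n) := B ∩ (fun y => (jacobian f y).det) ⁻¹' {0}ᶜ with hB'
  have hB'o : IsOpen B' := hdets.isOpen_inter_preimage hB isOpen_compl_singleton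
  obtain ⟨ψ, hψf, hpψ, hψB, hψs⟩ := exists_smooth_openPartialHomeomorph hB'o
    (hfs.mono Set.inter_subset_left) (fun y hy => hy.2)
    (p := p) ⟨hp, by simpa [hjp] using hdet p hp⟩
  -- From `dλ = μ θ^{n-1}` and `θ^{n-1} = dX_{n-1} + s dλ` follows `(1 - μ s) dλ = μ dX_{n-1}`. If
  -- `1 - μ s` vanished, `μ` would be nonzero and the last row of the Jacobian would be zero.
  have hdlast : ∀ y ∈ B', ∃ ν : ℝ, ∀ k, pderiv lam k y = ν * jacobian f y (lastIndex hn) k := by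
    intro y hy
    obtain ⟨μ, hμ⟩ := hdl y hy.1
    have hμ' : ∀ k, pderiv lam k y = μ * K y (lastIndex hn) k := fun k => by
      rw [hμ, extendZero, dif_pos (by omega)]
      rfl
    set s : ℝ := (lastIndex hn).val * X ((lastIndex hn).val - 1) y with hs
    have hrel : ∀ k, (1 - μ * s) * pderiv lam k y = μ * jacobian f y (lastIndex hn) k := fun k => by
      rw [hjac y hy.1]
      linear_combination hμ' k
    have hne : 1 - μ * s ≠ 0 := fun h0 => hy.2 <| by
      have hμ0 : μ ≠ 0 := by
        rintro rfl
        simp at h0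
      refine Matrix.det_eq_zero_of_row_eq_zero (lastIndex hn) fun k => ?_
      have := hrel k
      rw [h0, zero_mul] at this
      exact (mul_eq_zero.mp this.symm).resolve_left hμ0
    refine ⟨μ / (1 - μ * s), fun k => ?_⟩
    rw [div_mul_eq_mul_div, eq_div_iff hne, ← hrel k]
    ring
  have hψp : ψ p = 0 := by rw [hψf, hfp]
  obtain ⟨r, hr, hball⟩ := Metric.isOpen_iff.mp ψ.open_target 0 (hψp ▸ ψ.map_source hpψ)
  set h : E n → ℝ := fun z => lam (ψ.symm z) with hh
  have hmaps : ∀ z ∈ ψ.target, ψ.symm z ∈ B' := fun z hz => hψB (ψ.map_target hz)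
  have hhs : ContDiffOn ℝ ∞ h ψ.target :=
    (hlam.mono Set.inter_subset_left).comp hψs hmaps
  have hhd : ∀ z ∈ ψ.target, DifferentiableAt ℝ h z := fun z hz =>
    (hhs.contDiffAt (ψ.open_target.mem_nhds hz)).differentiableAt (by simp)
  have hhz : ∀ z ∈ ψ.target, ∀ u : E n, u (lastIndex hn) = 0 → fderiv ℝ h z u = 0 := by
    intro z hz u hu
    have hyB := hmaps z hz
    have d1 : DifferentiableAt ℝ ψ.symm z :=
      (hψs.contDiffAt (ψ.open_target.mem_nhds hz)).differentiableAt (by simp)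
    have d2 : DifferentiableAt ℝ lam (ψ.symm z) :=
      (hlam.contDiffAt (hB.mem_nhds hyB.1)).differentiableAt (by simp)
    have d3 := hfd _ hyB.1
    obtain ⟨ν, hν⟩ := hdlast _ hyB
    have e1 : fderiv ℝ h z u = fderiv ℝ lam (ψ.symm z) (fderiv ℝ ψ.symm z u) := by
      have := (d2.hasFDerivAt.comp z d1.hasFDerivAt).fderiv
      simp only [Function.comp_def] at this
      simp [hh, this]
    have e2 : fderiv ℝ f (ψ.symm z) (fderiv ℝ ψ.symm z u) = u := by
      have h1 := d3.hasFDerivAt.comp z d1.hasFDerivAt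
      have h2 : (f ∘ ψ.symm) =ᶠ[𝓝 z] id := by
        filter_upwards [ψ.open_target.mem_nhds hz] with y hy
        rw [← hψf]
        exact ψ.right_inv hy
      have h3 := (h1.congr_of_eventuallyEq h2.symm).unique (hasFDerivAt_id z)
      exact congrArg (fun L : E n →L[ℝ] E n => L u) h3
    have e3 := fderiv_apply_eq_jacobian_mulVec f (ψ.symm z) (fderiv ℝ ψ.symm z u) (lastIndex hn)
    rw [e2, hu] at e3
    rw [e1, fderiv_eq_sum_pderiv]
    calc ∑ k, (fderiv ℝ ψ.symm z u) k * pderiv lam k (ψ.symm z)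
        = ν * (jacobian f (ψ.symm z) *ᵥ (fderiv ℝ ψ.symm z u).ofLp) (lastIndex hn) := by
          rw [Matrix.mulVec, dotProduct, Finset.mul_sum]
          exact Finset.sum_congr rfl fun k _ => by rw [hν]; ring
      _ = 0 := by rw [← e3, mul_zero]
  -- The eigenvalue restricted to the last coordinate axis is the function of one variable sought.
  set lam₀ : ℝ → ℝ := fun t => h (EuclideanSpace.single (lastIndex hn) t) with hlam₀
  have hlam₀s : ContDiffOn ℝ ∞ lam₀ (Set.Ioo (-r) r) := by
    refine hhs.comp (t := ψ.target) ?_ fun t ht => hball ?_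
    · refine (contDiff_euclidean.mpr fun i => ?_).contDiffOn
      by_cases hi : i = lastIndex hn
      · subst hi
        simpa using contDiff_fun_id
      · simpa [hi] using contDiff_const
    · rw [mem_ball_zero_iff, PiLp.norm_single]
      exact abs_lt.mpr ht
  obtain ⟨F, hFs, hF⟩ := exists_smooth_extension hr hlam₀s
  -- Within radius `r / 3` the cut-off extension `F` agrees with `lam₀`.
  set ψ' := ψ.restrOpen (B' ∩ f ⁻¹' Metric.ball 0 (r / 3))
    ((hfs.mono Set.inter_subset_left).continuousOn.isOpen_inter_preimage hB'o Metric.isOpen_ball)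
    with hψ'
  have hcoe : (ψ' : E n → E n) = f := hψf
  have hsrc : ∀ y ∈ ψ'.source, y ∈ B' ∧ y ∈ ψ.source ∧ f y ∈ Metric.ball (0 : E n) (r / 3) :=
    fun y hy => ⟨hy.2.1, hy.1, hy.2.2⟩
  have hval : ∀ y ∈ ψ'.source, lam y = F (coord (f y) n) := fun y hy => by
    obtain ⟨hyB, hyψ, hyr⟩ := hsrc y hy
    have hyr' : f y ∈ Metric.ball (0 : E n) r := Metric.ball_subset_ball (by linarith) hyr
    have e := (eq_of_fderiv_eq_zero_of_last hn (h := h) (fun z hz => hhd z (hball hz))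
      (fun z hz => hhz z (hball hz)) hyr').2
    have e' : h (f y) = lam y := by
      simp only [hh]
      rw [← hψf, ψ.left_inv hyψ]
    rw [← e', e, coord_eq_lastIndex hn, hF]
    have := PiLp.norm_apply_le (f y) (lastIndex hn)
    rw [Real.norm_eq_abs] at this
    exact lt_of_le_of_lt this (by simpa using hyr)
  refine ⟨ψ', F, ⟨hpψ, hψB hpψ, by simpa [hfp] using hr⟩, fun y hy => (hsrc y hy).1.1, ?_, ?_, hFs,
    ?_, ?_⟩
  · rw [hcoe]
    exact hfs.mono fun y hy => (hsrc y hy).1.1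
  · exact hψs.mono fun z hz => hz.1
  · rw [hcoe]
    exact hval
  · intro y hy
    have hyB := (hsrc y hy).1.1
    rw [hcoe]
    ext i k
    have hlast : pderiv lam k y
        = deriv F (coord (f y) n) * jacobian f y (lastIndex hn) k := by
      have hc : ∀ z, coord (f z) n = X (lastIndex hn).val z := fun z => coord_eq_lastIndex hn _
      have h1 : lam =ᶠ[𝓝 y] fun z => F (X (lastIndex hn).val z) := by
        filter_upwards [ψ'.open_source.mem_nhds hy] with z hz
        rw [hval z hz, hc]
      rw [pderiv_congr h1, pderiv_comp (hFs.differentiable (by simp) _)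
        (((hX _ (lastIndex hn).isLt).1.contDiffAt (hB.mem_nhds hyB)).differentiableAt (by simp)),
        hc, jacobian_apply (hfd y hyB)]
    have hcoord : (i.val : ℝ) * coord (f y) i.val = i.val * X (i.val - 1) y := by
      rcases Nat.eq_zero_or_pos i.val with h0 | h0
      · simp [h0]
      · rw [coord, dif_pos ⟨h0, i.isLt.le⟩]
    rw [normalCoframe_mul_apply hn, hjac y hyB i k, hlast]
    linear_combination (-deriv F (coord (f y) n) * jacobian f y (lastIndex hn) k) * hcoord

end NormalCoframe

/-! ### The normal forms are compatible. -/

section Converse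

variable {n : ℕ}

/-- A coframe satisfying the structure equations defines a metric with which the corresponding
field of Jordan blocks is compatible. -/
theorem covDeriv_eq_of_coframe_structure {U : Set (E n)} (hU : IsOpen U)
    {G A K : E n → Matrix (Fin n) (Fin n) ℝ} {lam : E n → ℝ} {ε : ℝ} {x : E n} (hε : ε ≠ 0)
    (hdet : ∀ y ∈ U, (K y).det ≠ 0) (hK : EntriesDifferentiableAt K x)
    (hA : EntriesDifferentiableAt A x) (hlam : DifferentiableAt ℝ lam x)
    (hGK : ∀ y ∈ U, G y = ε • ((K y)ᵀ * reversal n * K y))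
    (hKA : ∀ y ∈ U, K y * A y = jordanBlock n (lam y) * K y) (hx : x ∈ U) {μ : ℝ}
    (hdl : ∀ k, pderiv lam k x = μ * extendZero (fun i => K x i k) (n - 1))
    (hstr : ∀ m j k, pderiv (fun y => K y m j) k x - pderiv (fun y => K y m k) j x =
        -(m.val * (pderiv lam k x * extendZero (fun i => K x i j) (m.val - 1)
          - pderiv lam j x * extendZero (fun i => K x i k) (m.val - 1)))) (u : Fin n → ℝ) :
    covDeriv G A x u =
      (1 / 2 : ℝ) • (tensorDTrace A x u + adjointWrt (G x) (tensorDTrace A x u)) := by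
  have hUx := hU.mem_nhds hx
  have hu : IsUnit (K x).det := isUnit_iff_ne_zero.mpr (hdet x hx)
  have h1 : K x * (K x)⁻¹ = 1 := Matrix.mul_nonsing_inv _ hu
  have h2 : (K x)⁻¹ * K x = 1 := Matrix.nonsing_inv_mul _ hu
  have hsymm : ∀ᶠ y in 𝓝 x, (G y).IsSymm := by
    filter_upwards [hUx] with y hy
    rw [hGK y hy, Matrix.IsSymm, Matrix.transpose_smul, Matrix.transpose_mul,
      Matrix.transpose_mul, Matrix.transpose_transpose, reversal_transpose, Matrix.mul_assoc]
  have hGdet : (G x).det ≠ 0 := by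
    rw [hGK x hx, Matrix.det_smul, Matrix.det_mul, Matrix.det_mul, Matrix.det_transpose]
    exact mul_ne_zero (pow_ne_zero _ hε)
      (mul_ne_zero (mul_ne_zero (hdet x hx) reversal_det_ne_zero) (hdet x hx))
  set c : Fin n → Fin n → ℝ := fun k i => K x i k with hc
  set W : Fin n → Matrix (Fin n) (Fin n) ℝ := fun k => frameConnection μ (c k) with hW
  -- The coordinate expression of the connection with coframe form `W`. The structure equations make
  -- it torsion-free and skewness of `W` makes it metric, so it is the Levi-Civita connection.
  set C : Fin n → Matrix (Fin n) (Fin n) ℝ := fun k =>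
    (K x)⁻¹ * (W k * K x + matrixPderiv K k x) with hC
  have hKC : ∀ k, K x * C k = W k * K x + matrixPderiv K k x := fun k => by
    simp only [hC]
    rw [← Matrix.mul_assoc, h1, Matrix.one_mul]
  have hcomm : ∀ i k j, C k i j = C j i k := fun i k j => by
    have hcol : ∀ m k j, (W k * K x + matrixPderiv K k x) m j
        = (frameConnection μ (c k) *ᵥ c j) m + pderiv (fun y => K y m j) k x := fun _ _ _ => rfl
    simp only [hC, Matrix.mul_apply (M := (K x)⁻¹)]
    refine Finset.sum_congr rfl fun m _ => ?_
    rw [hcol, hcol]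
    have ht := frameConnection_mulVec_sub μ (c k) (c j) m
    have hs := hstr m j k
    rw [hdl k, hdl j] at hs
    congr 1
    linear_combination ht + hs
  have hconn : ∀ k, connectionMatrix G x k = C k := fun k =>
    connectionMatrix_eq_of_metric_of_comm hsymm hGdet hcomm (fun k =>
      (skew_of_metric hε (hdet x hx) (hGK x hx)
        (matrixPderiv_coframe_metric hK (Filter.eventually_of_mem hUx hGK) k) (hKC k)).mpr
        (frameConnection_skew μ (c k))) k
  refine covDeriv_eq_of_forall_single (fun k => ?_) u
  have hℓ : ∀ i : Fin n, ((fun j => pderiv lam j x) ᵥ* (K x)⁻¹) i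
      = if i.val + 1 = n then μ else 0 := by
    have hn : 0 < n := k.pos
    have e : (fun j => pderiv lam j x)
        = (fun i : Fin n => if i.val + 1 = n then μ else 0) ᵥ* K x := by
      ext j
      rw [hdl j, Matrix.vecMul, dotProduct, Finset.sum_eq_single (lastIndex hn)]
      · rw [if_pos (by simp [lastIndex]; omega), extendZero, dif_pos (by omega)]
        rfl
      · intro l _ hl
        rw [if_neg, zero_mul]
        exact fun h => hl (Fin.ext (by simp [lastIndex]; omega))
      · simp
    intro i
    rw [e, Matrix.vecMul_vecMul, h1, Matrix.vecMul_one]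
  have hT := coframe_tensorDTrace hlam (Filter.eventually_of_mem hUx hdet)
    (Filter.eventually_of_mem hUx hKA) k
  have hL := coframe_covPderiv hK hA hlam (hdet x hx) (Filter.eventually_of_mem hUx hKA)
    (G := G) (W := W k) (k := k) (by rw [hconn, hKC])
  have hR : K x * ((1 / 2 : ℝ) • (tensorDTrace A x (Pi.single k 1)
      + adjointWrt (G x) (tensorDTrace A x (Pi.single k 1)))) * (K x)⁻¹
      = W k * jordanBlock n 0 - jordanBlock n 0 * W k + pderiv lam k x • 1 := by
    rw [Matrix.mul_smul, Matrix.smul_mul, Matrix.mul_add, Matrix.add_mul,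
      coframe_adjointWrt hε (hdet x hx) (hGK x hx), hT, coframe_compatibility_rhs hℓ, hdl k,
      ← frameConnection_bracket]
  have h := congrArg (fun M => (K x)⁻¹ * M * K x) (hL.trans hR.symm)
  have hcancel : ∀ M, (K x)⁻¹ * (K x * M * (K x)⁻¹) * K x = M := fun M => by
    calc (K x)⁻¹ * (K x * M * (K x)⁻¹) * K x
        = ((K x)⁻¹ * K x) * M * ((K x)⁻¹ * K x) := by simp only [Matrix.mul_assoc]
      _ = M := by rw [h2, Matrix.one_mul, Matrix.mul_one]
  simpa only [hcancel] using h

/-- The coframe is the identity plus a last column `b` with `b_m = m λ' x_m`. Expanding the square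
gives the antidiagonal, two cross terms in the last row and column, and a corner `∑ b_m b_{n-1-m}`.
The ends of that sum vanish because `b_0 = 0`, leaving products of `a_k = b_k` with `1 ≤ k ≤ n - 2`.
The summand `1` in `a_{n-1}` is the end of the antidiagonal. -/
theorem gNormal_eq (hn : 0 < n) (lam : ℝ → ℝ) (x : E n) :
    gNormal lam x = (normalCoframe lam x)ᵀ * reversal n * normalCoframe lam x := by
  set b : ℕ → ℝ := fun k => k * deriv lam (coord x n) * coord x k with hb
  have hb0 : b 0 = 0 := by simp [hb]
  have hK : ∀ i j : Fin n, normalCoframe lam x i j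
      = (if i = j then 1 else 0) + if j.val + 1 = n then b i.val else 0 := fun _ _ => rfl
  have ha : ∀ k, aCoeff lam x k = (if k + 1 = n then 1 else 0) + b k := fun _ => rfl
  ext i j
  have key : ((normalCoframe lam x)ᵀ * reversal n * normalCoframe lam x) i j
      = (if i.rev = j then 1 else 0) + (if j.val + 1 = n then b i.rev.val else 0)
        + (if i.val + 1 = n then b j.rev.val else 0)
        + (if i.val + 1 = n then (if j.val + 1 = n then
            ∑ m : Fin n, b m.val * b m.rev.val else 0) else 0) := by
    rw [Matrix.mul_assoc, Matrix.mul_apply]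
    simp only [Matrix.transpose_apply, reversal_mul_apply, hK, add_mul, ite_mul, one_mul, zero_mul,
      Finset.sum_add_distrib, Finset.sum_ite_eq', Finset.mem_univ, if_true]
    have hrev : ∀ m : Fin n, (m.rev = j) ↔ m = j.rev := fun m => Fin.rev_eq_iff
    by_cases hi : i.val + 1 = n <;> by_cases hj : j.val + 1 = n <;>
      simp only [hi, hj, if_true, if_false, hrev, mul_add, mul_ite, mul_one,
        mul_zero, Finset.sum_add_distrib, Finset.sum_ite_eq', Finset.mem_univ,
        Finset.sum_const_zero, add_zero, add_assoc]
  rw [key]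
  simp only [gNormal, Matrix.of_apply, ha, Fin.ext_iff, Fin.val_rev]
  by_cases hi : i.val + 1 = n
  · have hi' : ¬ i.val + 1 < n := by omega
    by_cases hj : j.val + 1 = n
    · have hj' : ¬ j.val + 1 < n := by omega
      have e1 : n - (i.val + 1) = 0 := by omega
      have e2 : n - (j.val + 1) = 0 := by omega
      simp only [if_pos hi, if_pos hj, if_neg hi', if_neg hj', e1, e2, hb0, add_zero]
      -- For `n = 1` the corner is the single antidiagonal entry; for `n ≥ 2` the two end summands
      -- are removed and the index is shifted by one.
      rw [← Finset.sum_range (fun m => b m * b (n - (m + 1)))]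
      by_cases h1 : n = 1
      · have : 0 = j.val := by omega
        rw [if_pos h1, if_pos this]
        subst h1
        simp [hb0]
      · have : ¬ 0 = j.val := by omega
        rw [if_neg h1, if_neg this, zero_add]
        obtain ⟨k, rfl⟩ : ∃ k, n = k + 2 := ⟨n - 2, by omega⟩
        rw [Finset.sum_range_succ, Finset.sum_range_succ']
        have e3 : k + 2 - (k + 1 + 1) = 0 := by omega
        rw [e3, hb0, zero_mul, mul_zero, add_zero, add_zero, Nat.add_sub_cancel,
          Finset.range_eq_Ico, Finset.sum_Ico_add' (fun m => b m * b (k + 2 - (m + 1))) 0 k 1]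
        refine Finset.sum_congr (by ext; simp) fun m hm => ?_
        have hm' := Finset.mem_Ico.mp hm
        rw [if_neg (by omega), if_neg (by omega), zero_add, zero_add]
        congr 2
    · have hj' : j.val + 1 < n := by omega
      simp only [if_pos hi, if_neg hj, if_neg hi', if_pos hj', add_zero]
      congr 1
      exact if_congr (by omega) rfl rfl
  · have hi' : i.val + 1 < n := by omega
    by_cases hj : j.val + 1 = n
    · have hj' : ¬ j.val + 1 < n := by omega
      simp only [if_neg hi, if_pos hj, if_pos hi', if_neg hj', add_zero]
      congr 1
      exact if_congr (by omega) rfl rfl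
    · have hj' : j.val + 1 < n := by omega
      simp only [if_neg hi, if_neg hj, if_pos hi', if_pos hj', add_zero]
      exact if_congr (by omega) rfl rfl

theorem normalCoframe_mul_lNormal (hn : 0 < n) (lam : ℝ → ℝ) (x : E n) :
    normalCoframe lam x * lNormal lam x = jordanBlock n (lam (coord x n)) * normalCoframe lam x := by
  set b : ℕ → ℝ := fun k => k * deriv lam (coord x n) * coord x k with hb
  have hK : ∀ i j : Fin n, normalCoframe lam x i j
      = (if i = j then 1 else 0) + if j.val + 1 = n then b i.val else 0 := fun _ _ => rfl
  have ha : ∀ k, aCoeff lam x k = (if k + 1 = n then 1 else 0) + b k := fun _ => rfl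
  ext i j
  rw [normalCoframe_mul_apply hn, jordanBlock_eq, Matrix.add_mul, Matrix.add_apply,
    jordanBlock_zero_mul_apply, Matrix.smul_mul, Matrix.one_mul, Matrix.smul_apply]
  change _ + b i.val * _ = _
  simp only [hK, lNormal, Matrix.of_apply, ha, lastIndex, smul_eq_mul, Fin.ext_iff]
  have e1 : (n - 1 + 1 = j.val + 1) ↔ j.val + 1 = n := by omega
  have e2 : ¬ (j.val + 1 = n - 1 + 1 + 1) := by omega
  have e3 : (i.val + 1 = j.val + 1) ↔ i.val = j.val := by omega
  have e4 : (j.val + 1 = i.val + 1 + 1) ↔ i.val + 1 = j.val := by omega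
  simp only [e1, if_neg e2, e3, e4]
  have hi := i.isLt
  have hj := j.isLt
  by_cases hjn : j.val + 1 = n
  · by_cases hij : i.val = j.val
    · have : ¬ i.val + 1 < n := by omega
      simp [hjn, hij]
      ring
    · have h1 : i.val + 1 < n := by omega
      have h2 : (i.val + 1 + 1 = n) ↔ i.val + 1 = j.val := by omega
      simp only [if_pos hjn, if_neg hij, dif_pos h1, h2]
      ring
  · by_cases hij : i.val = j.val
    · have : ¬ i.val + 1 = j.val := by omega
      simp [hjn, hij]
    · by_cases h : i.val + 1 = j.val
      · have h1 : i.val + 1 < n := by omega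
        simp only [if_neg hjn, if_neg hij, if_pos h, dif_pos h1]
        ring
      · simp [hjn, hij, h]

theorem normalCoframe_det (hn : 0 < n) (lam : ℝ → ℝ) (x : E n) :
    (normalCoframe lam x).det
      = 1 + ((n : ℝ) - 1) * deriv lam (coord x n) * coord x (n - 1) := by
  have htri : (normalCoframe lam x).BlockTriangular id := fun i j hij => by
    have h1 : ¬ i = j := fun h => by simp [h] at hij
    have h2 : ¬ j.val + 1 = n := by
      have : j.val < i.val := hij
      omega
    simp [normalCoframe, h1, h2]
  rw [Matrix.det_of_isUpperTriangular htri, Finset.prod_eq_single (lastIndex hn)]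
  · have : n - 1 + 1 = n := by omega
    simp [normalCoframe, lastIndex, this, Nat.cast_sub (Nat.one_le_iff_ne_zero.mpr hn.ne')]
  · intro i _ hi
    have : ¬ i.val + 1 = n := fun h => hi (Fin.ext (by simp [lastIndex]; omega))
    simp [normalCoframe, this]
  · simp

theorem gNormal_det (hn : 0 < n) (lam : ℝ → ℝ) (x : E n) :
    (gNormal lam x).det ≠ 0 ↔ (normalCoframe lam x).det ≠ 0 := by
  rw [gNormal_eq hn, Matrix.det_mul, Matrix.det_mul, Matrix.det_transpose]
  have := reversal_det_ne_zero (n := n)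
  simp [this]

theorem contDiff_coord (k : ℕ) : ContDiff ℝ ∞ fun x : E n => coord x k := by
  by_cases h : 1 ≤ k ∧ k ≤ n
  · simp only [coord, dif_pos h]
    exact (EuclideanSpace.proj (⟨k - 1, by omega⟩ : Fin n) : E n →L[ℝ] ℝ).contDiff
  · simp only [coord, dif_neg h]
    exact contDiff_const

theorem pderiv_coord (m : ℕ) (k : Fin n) (x : E n) :
    pderiv (fun y => coord y m) k x = if k.val + 1 = m then 1 else 0 := by
  by_cases h : 1 ≤ m ∧ m ≤ n
  · simp only [coord, dif_pos h, pderiv_apply, Fin.ext_iff]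
    exact if_congr (by omega) rfl rfl
  · simp only [coord, dif_neg h, pderiv_const]
    rw [if_neg (by omega)]

/-- The domain `x_n ∈ I` of the normal forms. -/
theorem isOpen_coord_preimage {I : Set ℝ} (hI : IsOpen I) : IsOpen {x : E n | coord x n ∈ I} :=
  hI.preimage (contDiff_coord n).continuous

theorem contDiffOn_deriv_coord {I : Set ℝ} (hI : IsOpen I) {lam : ℝ → ℝ}
    (hlam : ContDiffOn ℝ ∞ lam I) :
    ContDiffOn ℝ ∞ (fun x : E n => deriv lam (coord x n)) {x | coord x n ∈ I} :=
  (hlam.deriv_of_isOpen (m := ∞) hI (by simp)).comp (contDiff_coord n).contDiffOn fun _ hx => hx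

theorem smoothEntriesOn_normalCoframe {I : Set ℝ} (hI : IsOpen I) {lam : ℝ → ℝ}
    (hlam : ContDiffOn ℝ ∞ lam I) :
    SmoothEntriesOn (n := n) (normalCoframe lam) {x | coord x n ∈ I} := fun i j => by
  simp only [normalCoframe, Matrix.of_apply]
  refine contDiffOn_const.add ?_
  split_ifs
  · exact (contDiffOn_const.mul (contDiffOn_deriv_coord hI hlam)).mul
      (contDiff_coord _).contDiffOn
  · exact contDiffOn_const

theorem smoothEntriesOn_lNormal {I : Set ℝ} (hI : IsOpen I) {lam : ℝ → ℝ}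
    (hlam : ContDiffOn ℝ ∞ lam I) :
    SmoothEntriesOn (n := n) (lNormal lam) {x | coord x n ∈ I} := fun i j => by
  simp only [lNormal, Matrix.of_apply, aCoeff]
  split_ifs <;> first
    | exact contDiffOn_const
    | exact hlam.comp (contDiff_coord n).contDiffOn fun _ hx => hx
    | exact contDiffOn_const.add ((contDiffOn_const.mul (contDiffOn_deriv_coord hI hlam)).mul
        (contDiff_coord _).contDiffOn)

/-- The structure equations of the normal coframe. -/
theorem normalCoframe_structure {I : Set ℝ} (hI : IsOpen I) {lam : ℝ → ℝ}
    (hlam : ContDiffOn ℝ ∞ lam I) {x : E n} (hx : coord x n ∈ I) (m j k : Fin n) :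
    pderiv (fun y => normalCoframe lam y m j) k x - pderiv (fun y => normalCoframe lam y m k) j x =
      -(m.val * (pderiv (fun y => lam (coord y n)) k x
            * extendZero (fun i => normalCoframe lam x i j) (m.val - 1)
          - pderiv (fun y => lam (coord y n)) j x
            * extendZero (fun i => normalCoframe lam x i k) (m.val - 1))) := by
  have hIx := hI.mem_nhds hx
  have d0 : ∀ k, DifferentiableAt ℝ (fun y : E n => coord y k) x := fun k =>
    (contDiff_coord k).differentiable (by simp) x
  have d1 : DifferentiableAt ℝ lam (coord x n) :=
    (hlam.contDiffAt hIx).differentiableAt (by simp)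
  have d2 : DifferentiableAt ℝ (deriv lam) (coord x n) :=
    ((hlam.deriv_of_isOpen (m := ∞) hI (by simp)).contDiffAt hIx).differentiableAt (by simp)
  have d3 : DifferentiableAt ℝ (fun y : E n => deriv lam (coord y n)) x :=
    ((contDiffOn_deriv_coord hI hlam).contDiffAt
      ((isOpen_coord_preimage hI).mem_nhds hx)).differentiableAt (by simp)
  have hl : ∀ k, pderiv (fun y : E n => lam (coord y n)) k x
      = if k.val + 1 = n then deriv lam (coord x n) else 0 := fun k => by
    rw [pderiv_comp (f := fun y : E n => coord y n) d1 (d0 n), pderiv_coord]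
    simp
  have hd : ∀ j k, pderiv (fun y => normalCoframe lam y m j) k x
      = if j.val + 1 = n then m.val * ((if k.val + 1 = n then deriv (deriv lam) (coord x n) else 0)
          * coord x m.val + deriv lam (coord x n) * (if k.val + 1 = m.val then 1 else 0))
        else 0 := fun j k => by
    simp only [normalCoframe, Matrix.of_apply]
    by_cases hj : j.val + 1 = n
    · simp only [if_pos hj, mul_assoc]
      rw [pderiv_add (differentiableAt_const _) ((d3.fun_mul (d0 _)).const_mul _), pderiv_const,
        pderiv_const_mul _ (d3.fun_mul (d0 _)), pderiv_mul d3 (d0 _), pderiv_coord,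
        pderiv_comp (f := fun y : E n => coord y n) d2 (d0 n), pderiv_coord]
      simp
    · simp only [if_neg hj, add_zero, pderiv_const]
  -- The factor `m` is kept on both sides so that the truncated `m - 1` does no harm at `m = 0`.
  have he : ∀ j : Fin n, (m.val : ℝ) * extendZero (fun i => normalCoframe lam x i j) (m.val - 1)
      = m.val * ((if j.val + 1 = m.val then 1 else 0) + if j.val + 1 = n then
        ((m.val - 1 : ℕ) : ℝ) * deriv lam (coord x n) * coord x (m.val - 1) else 0) := fun j => by
    rcases Nat.eq_zero_or_pos m.val with h0 | h0
    · simp [h0]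
    · rw [extendZero, dif_pos (by omega)]
      simp only [normalCoframe, Matrix.of_apply, Fin.ext_iff]
      congr 2
      exact if_congr (by omega) rfl rfl
  rw [hd, hd, hl, hl]
  have h1 := he j
  have h2 := he k
  -- Only the last column varies, so a nonzero side needs `j` or `k` to be the last index. When both
  -- are, the `λ''` terms cancel.
  split_ifs at h1 h2 ⊢ <;> first
    | omega
    | ring1
    | linear_combination deriv lam (coord x n) * h1
    | linear_combination (-deriv lam (coord x n)) * h2
    | linear_combination deriv lam (coord x n) * h1 - deriv lam (coord x n) * h2

/-- The normal forms are compatible where the metric is nondegenerate. -/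
theorem normalForm_compatible (hn : 0 < n) {I : Set ℝ} {lam : ℝ → ℝ} {ε : ℝ} (hI : IsOpen I)
    (hlam : ContDiffOn ℝ ∞ lam I) (hne : ∀ t ∈ I, lam t ≠ 0) (hε : ε ≠ 0) :
    IsMetricOn {x : E n | coord x n ∈ I ∧ (gNormal lam x).det ≠ 0} (fun x => ε • gNormal lam x) ∧
    IsCompatibleOn {x : E n | coord x n ∈ I ∧ (gNormal lam x).det ≠ 0}
      (fun x => ε • gNormal lam x) (fun x => lNormal lam x) := by
  set U : Set (E n) := {x : E n | coord x n ∈ I ∧ (gNormal lam x).det ≠ 0} with hUdef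
  have hUI : U ⊆ {x : E n | coord x n ∈ I} := fun x hx => hx.1
  have hdet : ∀ x ∈ U, (normalCoframe lam x).det ≠ 0 := fun x hx => (gNormal_det hn lam x).mp hx.2
  have hGK : ∀ x ∈ U, ε • gNormal lam x
      = ε • ((normalCoframe lam x)ᵀ * reversal n * normalCoframe lam x) := fun x _ => by
    rw [gNormal_eq hn]
  have hU : IsOpen U := by
    have h : U = {x : E n | coord x n ∈ I} ∩ (fun x : E n => 1 + ((n : ℝ) - 1)
        * deriv lam (coord x n) * coord x (n - 1)) ⁻¹' {0}ᶜ := by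
      ext x
      rw [hUdef, Set.mem_ofPred_eq, gNormal_det hn, normalCoframe_det hn]
      rfl
    rw [h]
    exact (continuousOn_const.add ((continuousOn_const.mul
      (contDiffOn_deriv_coord hI hlam).continuousOn).mul
        (contDiff_coord _).continuous.continuousOn)).isOpen_inter_preimage
      (isOpen_coord_preimage hI) isOpen_compl_singleton
  have hKs : SmoothEntriesOn (normalCoframe lam) U := (smoothEntriesOn_normalCoframe hI hlam).mono hUI
  have hAs : SmoothEntriesOn (lNormal lam) U := (smoothEntriesOn_lNormal hI hlam).mono hUI
  have hsymm : ∀ x : E n, (ε • gNormal lam x).IsSymm := fun x => by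
    rw [gNormal_eq hn, Matrix.IsSymm, Matrix.transpose_smul, Matrix.transpose_mul,
      Matrix.transpose_mul, Matrix.transpose_transpose, reversal_transpose, Matrix.mul_assoc]
  have hKA := normalCoframe_mul_lNormal hn lam
  refine ⟨⟨fun i j => ?_, fun x _ => hsymm x, fun x hx => ?_⟩,
    ⟨hAs, fun x hx => ?_, fun x hx => ?_, fun x hx u => ?_⟩⟩
  · simp only [gNormal_eq hn, Matrix.smul_apply, smul_eq_mul]
    exact contDiffOn_const.mul ((SmoothEntriesOn.mul (SmoothEntriesOn.mul (fun i j => hKs j i)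
      (smoothEntriesOn_const _)) hKs) i j)
  · rw [Matrix.det_smul]
    exact mul_ne_zero (pow_ne_zero _ hε) hx.2
  · set K := normalCoframe lam x
    set J := jordanBlock n (lam (coord x n)) with hJ
    have hJR : Jᵀ * reversal n = reversal n * J := by
      rw [hJ, jordanBlock_eq, Matrix.transpose_add, ← reversal_mul_jordanBlock_mul_reversal,
        Matrix.add_mul, Matrix.mul_add, Matrix.mul_assoc _ _ (reversal n), reversal_mul_self]
      simp
    have hKAx : K * lNormal lam x = J * K := hKA x
    rw [gNormal_eq hn, Matrix.mul_smul, Matrix.smul_mul]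
    congr 1
    calc (lNormal lam x)ᵀ * (Kᵀ * reversal n * K)
        = (K * lNormal lam x)ᵀ * reversal n * K := by
          rw [Matrix.transpose_mul]
          simp only [Matrix.mul_assoc]
      _ = Kᵀ * (Jᵀ * reversal n) * K := by
          rw [hKAx, Matrix.transpose_mul]
          simp only [Matrix.mul_assoc]
      _ = Kᵀ * reversal n * K * lNormal lam x := by
          rw [hJR, Matrix.mul_assoc (Kᵀ * reversal n), hKAx]
          simp only [Matrix.mul_assoc]
  · have h := congrArg Matrix.det (hKA x)
    rw [Matrix.det_mul, Matrix.det_mul, mul_comm] at h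
    rw [mul_right_cancel₀ (hdet x hx) h]
    have htri : (jordanBlock n (lam (coord x n))).BlockTriangular id := fun i j hij => by
      have hij' : j.val < i.val := hij
      have h1 : ¬ i = j := fun h => by simp [h] at hij
      have h2 : ¬ j.val = i.val + 1 := by omega
      simp [jordanBlock, h1, h2]
    rw [Matrix.det_of_isUpperTriangular htri]
    refine Finset.prod_ne_zero_iff.mpr fun i _ => ?_
    simpa [jordanBlock] using hne _ hx.1
  · have hld : DifferentiableAt ℝ (fun y : E n => lam (coord y n)) x :=
      DifferentiableAt.comp x (g := lam) ((hlam.contDiffAt (hI.mem_nhds hx.1)).differentiableAt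
        (by simp)) ((contDiff_coord n).differentiable (by simp) x)
    refine covDeriv_eq_of_coframe_structure hU (K := normalCoframe lam)
      (lam := fun y => lam (coord y n)) hε hdet (hKs.entriesDifferentiableAt hU hx)
      (hAs.entriesDifferentiableAt hU hx) hld hGK (fun y _ => hKA y) hx
      -- The last coframe row is `(1 + (n-1) λ' x_{n-1}) dx_n`, whose coefficient is the determinant
      -- of the coframe; dividing `dλ = λ' dx_n` by it gives `μ`.
      (μ := deriv lam (coord x n) / (normalCoframe lam x).det) (fun k => ?_)
      (normalCoframe_structure hI hlam hx.1) u
    rw [pderiv_comp (f := fun y : E n => coord y n)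
      ((hlam.contDiffAt (hI.mem_nhds hx.1)).differentiableAt (by simp))
      ((contDiff_coord n).differentiable (by simp) x), pderiv_coord, extendZero,
      dif_pos (by omega)]
    by_cases hk : k.val + 1 = n
    · have e : normalCoframe lam x ⟨n - 1, by omega⟩ k = (normalCoframe lam x).det := by
        have e1 : n - 1 = k.val := by omega
        rw [normalCoframe_det hn]
        have e2 : (k.val : ℝ) = n - 1 := by
          have := congrArg (Nat.cast : ℕ → ℝ) hk
          push_cast at this
          linarith
        simp [normalCoframe, hk, Fin.ext_iff, e1, e2]
      rw [e, if_pos hk, div_mul_cancel₀ _ (hdet x hx), mul_one]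
    · have e : normalCoframe lam x ⟨n - 1, by omega⟩ k = 0 := by
        have e1 : ¬ n - 1 = k.val := by omega
        simp [normalCoframe, hk, Fin.ext_iff, e1]
      rw [e, if_neg hk, mul_zero, mul_zero]

end Converse

/-! ### Jordan blocks independently of bases, and passage between charts. -/

section Transfer

variable {n : ℕ}

theorem jordanBlock_zero_pow_apply (k : ℕ) (i j : Fin n) :
    (jordanBlock n 0 ^ k) i j = if j.val = i.val + k then 1 else 0 := by
  induction k generalizing i with
  | zero => simp [Matrix.one_apply, Fin.ext_iff, eq_comm]
  | succ k ih =>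
    rw [pow_succ', jordanBlock_zero_mul_apply]
    split_ifs with h h' h'
    · rw [ih, if_pos (by simp only; omega)]
    · rw [ih, if_neg (by simp only; omega)]
    · omega
    · rfl

theorem jordanBlock_zero_pow_self : jordanBlock n 0 ^ n = 0 := by
  ext i j
  rw [jordanBlock_zero_pow_apply, if_neg (by omega)]
  rfl

theorem jordanBlock_zero_pow_pred_ne_zero (hn : 0 < n) : jordanBlock n 0 ^ (n - 1) ≠ 0 := fun h => by
  have := congrFun (congrFun h ⟨0, hn⟩) (lastIndex hn)
  rw [jordanBlock_zero_pow_apply] at this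
  simp [lastIndex] at this

variable {V : Type*} [AddCommGroup V] [Module ℝ V] {T : V →ₗ[ℝ] V} {c : ℝ}

theorem IsSingleJordanBlock.trace_toMatrix (hT : IsSingleJordanBlock n T c)
    (b : Module.Basis (Fin n) ℝ V) : (LinearMap.toMatrix b b T).trace = n * c := by
  obtain ⟨b', hb'⟩ := hT
  rw [← LinearMap.trace_eq_matrix_trace, LinearMap.trace_eq_matrix_trace ℝ b', hb',
    trace_jordanBlock]

/-- Vanishing of a power of `T - c` does not depend on the basis. The Jordan bases, chosen point by
point without any continuity, thus enter only through the nilpotency order. -/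
theorem IsSingleJordanBlock.toMatrix_pow_eq_zero_iff (hT : IsSingleJordanBlock n T c)
    (b : Module.Basis (Fin n) ℝ V) (k : ℕ) :
    (LinearMap.toMatrix b b T - c • 1) ^ k = 0 ↔ jordanBlock n 0 ^ k = 0 := by
  obtain ⟨b', hb'⟩ := hT
  have h : ∀ b : Module.Basis (Fin n) ℝ V, (LinearMap.toMatrix b b T - c • 1) ^ k = 0
      ↔ (T - c • 1) ^ k = 0 := fun b => by
    have e : LinearMap.toMatrix b b T = LinearMap.toMatrixAlgEquiv b T := rfl
    rw [e, ← map_one (LinearMap.toMatrixAlgEquiv b), ← map_smul, ← map_sub, ← map_pow,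
      EmbeddingLike.map_eq_zero_iff]
  rw [h b, ← h b', hb', jordanBlock_eq, add_sub_cancel_left]

variable {M : Type*} [TopologicalSpace M] [ChartedSpace (E n) M]

/-- The coordinate basis of a tangent space. -/
theorem exists_basis_coordVec {φ : OpenPartialHomeomorph M (E n)}
    (hφ : φ.MDifferentiable (𝓡 n) (𝓡 n)) {y : E n} (hy : y ∈ φ.target)
    (L : EndField (n := n) M) :
    ∃ b : Module.Basis (Fin n) ℝ (TangentSpace (𝓡 n) (φ.symm y)),
      LinearMap.toMatrix b b (L (φ.symm y)) = endComponents φ L y := by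
  have h1 := hφ.comp_symm_deriv hy
  have h2 := hφ.symm_comp_deriv (φ.map_target hy)
  rw [φ.right_inv hy] at h2
  let e : E n ≃ₗ[ℝ] TangentSpace (𝓡 n) (φ.symm y) :=
    { toFun := fun u => mfderiv (𝓡 n) (𝓡 n) φ.symm y u
      invFun := fun v => mfderiv (𝓡 n) (𝓡 n) φ (φ.symm y) v
      map_add' := fun u v => map_add (mfderiv (𝓡 n) (𝓡 n) φ.symm y) u v
      map_smul' := fun a u => map_smul (mfderiv (𝓡 n) (𝓡 n) φ.symm y) a u
      left_inv := fun u => congrArg (fun f : E n →L[ℝ] E n => f u) h1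
      right_inv := fun v => congrArg
        (fun f : TangentSpace (𝓡 n) (φ.symm y) →L[ℝ] TangentSpace (𝓡 n) (φ.symm y) => f v) h2 }
  refine ⟨(EuclideanSpace.basisFun (Fin n) ℝ).toBasis.map e, ?_⟩
  ext i j
  rw [LinearMap.toMatrix_apply]
  simp only [Module.Basis.map_repr, Module.Basis.map_apply, LinearEquiv.trans_apply,
    OrthonormalBasis.coe_toBasis, EuclideanSpace.basisFun_apply,
    OrthonormalBasis.coe_toBasis_repr_apply, EuclideanSpace.basisFun_repr]
  rfl

theorem trans_mem_maximalAtlas [IsManifold (𝓡 n) ∞ M] {φ : OpenPartialHomeomorph M (E n)}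
    (hφ : φ ∈ IsManifold.maximalAtlas (𝓡 n) ∞ M) {ψ : OpenPartialHomeomorph (E n) (E n)}
    (hψ : ContDiffOn ℝ ∞ ψ ψ.source) (hψs : ContDiffOn ℝ ∞ ψ.symm ψ.target) :
    φ.trans ψ ∈ IsManifold.maximalAtlas (𝓡 n) ∞ M := by
  refine (IsManifold.mem_maximalAtlas_iff_contMDiffOn (I := 𝓡 n) (n := ∞) (φ.trans ψ)).mpr
    ⟨?_, ?_⟩
  · rw [OpenPartialHomeomorph.trans_source]
    exact hψ.contMDiffOn.comp' (contMDiffOn_of_mem_maximalAtlas hφ)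
  · rw [OpenPartialHomeomorph.trans_target]
    exact (contMDiffOn_symm_of_mem_maximalAtlas hφ).comp' hψs.contMDiffOn

/-! ### Transformation of components under a change of chart. -/

section ChangeOfChart

variable {φ : OpenPartialHomeomorph M (E n)} {ψ : OpenPartialHomeomorph (E n) (E n)} {y : E n}

theorem coordVec_trans (hφ : φ.MDifferentiable (𝓡 n) (𝓡 n))
    (hψs : ContDiffOn ℝ ∞ ψ.symm ψ.target) (hy : y ∈ (φ.trans ψ).target) (i : Fin n) :
    coordVec (φ.trans ψ) y i
      = ∑ k, jacobian ψ.symm y k i • coordVec φ (ψ.symm y) k := by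
  have hyψ : y ∈ ψ.target := hy.1
  have hyφ : ψ.symm y ∈ φ.target := hy.2
  have d1 : DifferentiableAt ℝ ψ.symm y :=
    (hψs.contDiffAt (ψ.open_target.mem_nhds hyψ)).differentiableAt (by simp)
  have h := (hφ.mdifferentiableAt_symm hyφ).hasMFDerivAt.comp y d1.hasFDerivAt.hasMFDerivAt
  have e : mfderiv (𝓡 n) (𝓡 n) (φ.trans ψ).symm y
      = (mfderiv (𝓡 n) (𝓡 n) φ.symm (ψ.symm y)).comp (fderiv ℝ ψ.symm y) := h.mfderiv
  have hu : fderiv ℝ ψ.symm y (EuclideanSpace.single i 1)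
      = ∑ k, jacobian ψ.symm y k i • EuclideanSpace.single k (1 : ℝ) := by
    ext l
    simp [jacobian, Pi.single_apply]
  change mfderiv (𝓡 n) (𝓡 n) (φ.trans ψ).symm y (EuclideanSpace.single i (1 : ℝ) : E n) = _
  rw [e]
  change mfderiv (𝓡 n) (𝓡 n) φ.symm (ψ.symm y)
    (fderiv ℝ ψ.symm y (EuclideanSpace.single i (1 : ℝ) : E n)) = _
  rw [hu]
  exact (map_sum (mfderiv (𝓡 n) (𝓡 n) φ.symm (ψ.symm y)) _ _).trans
    (Finset.sum_congr rfl fun k _ => map_smul _ _ _)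

theorem bilinComponents_trans (hφ : φ.MDifferentiable (𝓡 n) (𝓡 n))
    (hψs : ContDiffOn ℝ ∞ ψ.symm ψ.target) (hy : y ∈ (φ.trans ψ).target)
    (g : BilinField (n := n) M) :
    bilinComponents (φ.trans ψ) g y
      = (jacobian ψ.symm y)ᵀ * bilinComponents φ g (ψ.symm y) * jacobian ψ.symm y := by
  ext i j
  have e : bilinComponents (φ.trans ψ) g y i j
      = g (φ.symm (ψ.symm y)) (∑ k, jacobian ψ.symm y k i • coordVec φ (ψ.symm y) k)
        (∑ k, jacobian ψ.symm y k j • coordVec φ (ψ.symm y) k) := by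
    rw [← coordVec_trans hφ hψs hy, ← coordVec_trans hφ hψs hy]
    rfl
  have e' : ∀ v, g (φ.symm (ψ.symm y)) (∑ k, jacobian ψ.symm y k i • coordVec φ (ψ.symm y) k) v
      = ∑ k, jacobian ψ.symm y k i * g (φ.symm (ψ.symm y)) (coordVec φ (ψ.symm y) k) v :=
    fun v => by
      rw [map_sum (g (φ.symm (ψ.symm y)))]
      exact (LinearMap.sum_apply _ _ _).trans (Finset.sum_congr rfl fun k _ => by
        rw [map_smul]
        rfl)
  rw [e, e', Matrix.mul_assoc, Matrix.mul_apply]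
  refine Finset.sum_congr rfl fun k _ => ?_
  rw [map_sum, Matrix.transpose_apply, Matrix.mul_apply]
  congr 1
  refine Finset.sum_congr rfl fun l _ => ?_
  rw [map_smul, smul_eq_mul, mul_comm]
  rfl

theorem endComponents_trans (hφ : φ.MDifferentiable (𝓡 n) (𝓡 n))
    (hψ : ContDiffOn ℝ ∞ ψ ψ.source) (hψs : ContDiffOn ℝ ∞ ψ.symm ψ.target)
    (hy : y ∈ (φ.trans ψ).target) (L : EndField (n := n) M) :
    endComponents (φ.trans ψ) L y
      = jacobian ψ (ψ.symm y) * endComponents φ L (ψ.symm y) * jacobian ψ.symm y := by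
  have hyψ : y ∈ ψ.target := hy.1
  have hyφ : ψ.symm y ∈ φ.target := hy.2
  have d1 : DifferentiableAt ℝ ψ (φ (φ.symm (ψ.symm y))) := by
    rw [φ.right_inv hyφ]
    exact (hψ.contDiffAt (ψ.open_source.mem_nhds (ψ.map_target hyψ))).differentiableAt (by simp)
  have h := d1.hasFDerivAt.hasMFDerivAt.comp (φ.symm (ψ.symm y))
    (hφ.mdifferentiableAt (φ.map_target hyφ)).hasMFDerivAt
  have e : mfderiv (𝓡 n) (𝓡 n) (φ.trans ψ) (φ.symm (ψ.symm y))
      = (fderiv ℝ ψ (φ (φ.symm (ψ.symm y)))).comp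
        (mfderiv (𝓡 n) (𝓡 n) φ (φ.symm (ψ.symm y))) := h.mfderiv
  rw [φ.right_inv hyφ] at e
  set w : Fin n → E n := fun k => mfderiv (𝓡 n) (𝓡 n) φ (φ.symm (ψ.symm y))
    (L (φ.symm (ψ.symm y)) (coordVec φ (ψ.symm y) k)) with hw
  ext i j
  have e1 : endComponents (φ.trans ψ) L y i j
      = fderiv ℝ ψ (ψ.symm y) (∑ k, jacobian ψ.symm y k j • w k) i := by
    have e2 : (∑ k, jacobian ψ.symm y k j • w k)
        = mfderiv (𝓡 n) (𝓡 n) φ (φ.symm (ψ.symm y)) (L (φ.symm (ψ.symm y))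
          (coordVec (φ.trans ψ) y j)) := by
      rw [coordVec_trans hφ hψs hy]
      have e3 := map_sum (L (φ.symm (ψ.symm y)))
        (fun k => jacobian ψ.symm y k j • coordVec φ (ψ.symm y) k) Finset.univ
      have e4 := map_sum (mfderiv (𝓡 n) (𝓡 n) φ (φ.symm (ψ.symm y)))
        (fun k => L (φ.symm (ψ.symm y)) (jacobian ψ.symm y k j • coordVec φ (ψ.symm y) k))
        Finset.univ
      refine Eq.trans ?_ (e4.symm.trans (congrArg _ e3.symm))
      refine Finset.sum_congr rfl fun k _ => ?_
      rw [map_smul]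
      exact (map_smul (mfderiv (𝓡 n) (𝓡 n) φ (φ.symm (ψ.symm y))) _ _).symm
    rw [e2]
    exact congrArg (fun f : E n →L[ℝ] E n => f (L (φ.symm (ψ.symm y))
      (coordVec (φ.trans ψ) y j)) i) e
  have e5 : endComponents φ L (ψ.symm y) = Matrix.of fun l k => w k l := rfl
  rw [e1, fderiv_apply_eq_jacobian_mulVec, Matrix.mul_assoc, e5, Matrix.mul_apply, Matrix.mulVec,
    dotProduct]
  refine Finset.sum_congr rfl fun l _ => ?_
  congr 1
  simp [Matrix.mul_apply, mul_comm]

end ChangeOfChart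

theorem jacobian_mul_jacobian_symm {ψ : OpenPartialHomeomorph (E n) (E n)}
    (hψ : ContDiffOn ℝ ∞ ψ ψ.source) (hψs : ContDiffOn ℝ ∞ ψ.symm ψ.target) {y : E n}
    (hy : y ∈ ψ.target) : jacobian ψ (ψ.symm y) * jacobian ψ.symm y = 1 := by
  have d1 : DifferentiableAt ℝ ψ (ψ.symm y) :=
    (hψ.contDiffAt (ψ.open_source.mem_nhds (ψ.map_target hy))).differentiableAt (by simp)
  have d2 : DifferentiableAt ℝ ψ.symm y :=
    (hψs.contDiffAt (ψ.open_target.mem_nhds hy)).differentiableAt (by simp)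
  have h1 := d1.hasFDerivAt.comp y d2.hasFDerivAt
  have h2 : (ψ ∘ ψ.symm) =ᶠ[𝓝 y] id := by
    filter_upwards [ψ.open_target.mem_nhds hy] with z hz using ψ.right_inv hz
  have h3 := (h1.congr_of_eventuallyEq h2.symm).unique (hasFDerivAt_id y)
  ext i j
  have h4 : fderiv ℝ ψ (ψ.symm y) (fderiv ℝ ψ.symm y (EuclideanSpace.single j 1)) i
      = (EuclideanSpace.single j (1 : ℝ) : E n) i :=
    congrArg (fun L : E n →L[ℝ] E n => L (EuclideanSpace.single j 1) i) h3
  rw [fderiv_apply_eq_jacobian_mulVec] at h4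
  have h5 : (jacobian ψ (ψ.symm y) * jacobian ψ.symm y) i j
      = (jacobian ψ (ψ.symm y) *ᵥ
        (fderiv ℝ ψ.symm y (EuclideanSpace.single j 1)).ofLp) i := rfl
  rw [h5, h4]
  simp [Matrix.one_apply]

end Transfer

/-! ### Assembly of the local normal form. -/

section LocalNormalForm

variable {n : ℕ}

theorem IsMetricOn.mono {U V : Set (E n)} {G : E n → Matrix (Fin n) (Fin n) ℝ}
    (hG : IsMetricOn U G) (h : V ⊆ U) : IsMetricOn V G :=
  ⟨fun i j => (hG.smooth i j).mono h, fun x hx => hG.symm x (h hx),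
    fun x hx => hG.nondegenerate x (h hx)⟩

theorem IsCompatibleOn.mono {U V : Set (E n)} {G A : E n → Matrix (Fin n) (Fin n) ℝ}
    (hA : IsCompatibleOn U G A) (h : V ⊆ U) : IsCompatibleOn V G A :=
  ⟨fun i j => (hA.smooth i j).mono h, fun x hx => hA.selfadjoint x (h hx),
    fun x hx => hA.nondegenerate x (h hx), fun x hx => hA.covDeriv_eq x (h hx)⟩

/-- Normal coordinates for a compatible pair, whose tensor is a single Jordan block, on an open
subset of `ℝⁿ`. -/
theorem exists_normal_form_coordinates (hn : 0 < n) {U : Set (E n)} (hU : IsOpen U)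
    {G A : E n → Matrix (Fin n) (Fin n) ℝ} {lam : E n → ℝ} (hG : IsMetricOn U G)
    (hA : IsCompatibleOn U G A) (hlam : ContDiffOn ℝ ∞ lam U)
    (hnil : ∀ y ∈ U, (A y - lam y • 1) ^ n = 0) {p : E n} (hp : p ∈ U)
    (hAp : (A p - lam p • 1) ^ (n - 1) ≠ 0) :
    ∃ (ψ : OpenPartialHomeomorph (E n) (E n)) (ε : ℝ) (F : ℝ → ℝ), p ∈ ψ.source ∧ ψ.source ⊆ U ∧
      ContDiffOn ℝ ∞ ψ ψ.source ∧ ContDiffOn ℝ ∞ ψ.symm ψ.target ∧ (ε = 1 ∨ ε = -1) ∧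
      ContDiff ℝ ∞ F ∧ (∀ z ∈ ψ.source, lam z = F (coord (ψ z) n)) ∧
      ∀ y ∈ ψ.target,
        (jacobian ψ.symm y)ᵀ * G (ψ.symm y) * jacobian ψ.symm y = ε • gNormal F y ∧
        jacobian ψ (ψ.symm y) * A (ψ.symm y) * jacobian ψ.symm y = lNormal F y := by
  obtain ⟨V, ε, K, hV, hVU, hpV, hε, hK, hGK, hKA⟩ :=
    exists_canonical_coframe hU hG hA.smooth hlam hA.selfadjoint hnil hp hAp
  have hε0 : ε ≠ 0 := by rcases hε with h | h <;> simp [h]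
  obtain ⟨r, hr, hrV⟩ := Metric.isOpen_iff.mp hV p hpV
  -- A ball is convex, as the Poincaré lemma requires.
  set B := Metric.ball p r with hB
  have hBo : IsOpen B := Metric.isOpen_ball
  have hBU : B ⊆ U := hrV.trans hVU
  have hdet : ∀ y ∈ B, (K y).det ≠ 0 := fun y hy =>
    det_ne_zero_of_eq_smul (hG.nondegenerate y (hBU hy)) (hGK y (hrV hy))
  have hstr := fun y (hy : y ∈ B) => coframe_structure hBo (hG.mono hBU) (hA.mono hBU) hε0
    (fun y hy => hK.entriesDifferentiableAt hV (hrV hy))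
    (fun y hy => (hlam.contDiffAt (hU.mem_nhds (hBU hy))).differentiableAt (by simp))
    (fun y hy => hGK y (hrV hy)) (fun y hy => hKA y (hrV hy)) hy
  obtain ⟨ψ, F, hpψ, hψB, hψ, hψs, hF, hval, hcof⟩ := exists_normal_coordinates hn hBo
    (convex_ball p r) (hK.mono hrV) (hlam.mono hBU) hdet
    (fun y hy => ⟨_, (hstr y hy).choose_spec.1⟩) (fun y hy => (hstr y hy).choose_spec.2)
    (Metric.mem_ball_self hr)
  refine ⟨ψ, ε, F, hpψ, hψB.trans hBU, hψ, hψs, hε, hF, hval, fun y hy => ?_⟩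
  have hz := ψ.map_target hy
  set z := ψ.symm y with hzdef
  set J := jacobian ψ.symm y with hJ
  have hDJ : jacobian ψ z * J = 1 := jacobian_mul_jacobian_symm hψ hψs hy
  have hψz : ψ z = y := ψ.right_inv hy
  have hKz := hcof z hz
  rw [hψz] at hKz
  have hKJ : K z * J = normalCoframe F y := by
    rw [hKz, Matrix.mul_assoc, hDJ, Matrix.mul_one]
  have hdetN : IsUnit (normalCoframe F y).det := by
    refine isUnit_iff_ne_zero.mpr fun h => hdet z (hψB hz) ?_
    rw [hKz, Matrix.det_mul, h, zero_mul]
  constructor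
  · rw [hGK z (hrV (hψB hz)), gNormal_eq hn, ← hKJ, Matrix.mul_smul, Matrix.smul_mul,
      Matrix.transpose_mul]
    simp only [Matrix.mul_assoc]
  -- Both candidates for the matrix of the tensor are conjugated by the same invertible coframe to
  -- the same Jordan block, so it can be cancelled.
  · have h : normalCoframe F y * (jacobian ψ z * A z * J)
        = normalCoframe F y * lNormal F y := by
      rw [normalCoframe_mul_lNormal hn, ← hψz, ← hval z hz, hψz]
      calc normalCoframe F y * (jacobian ψ z * A z * J)
          = (normalCoframe F y * jacobian ψ z) * A z * J := by simp only [Matrix.mul_assoc]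
        _ = jordanBlock n (lam z) * (K z * J) := by
          rw [← hKz, hKA z (hrV (hψB hz)), Matrix.mul_assoc]
        _ = _ := by rw [hKJ]
    have := congrArg (fun M => (normalCoframe F y)⁻¹ * M) h
    simpa [← Matrix.mul_assoc, Matrix.nonsing_inv_mul _ hdetN] using this

/-- Normal form near a point of a manifold. -/
theorem exists_chart_normal_form (hn : 0 < n) {M : Type*} [TopologicalSpace M]
    [ChartedSpace (E n) M] [IsManifold (𝓡 n) ∞ M] {g : BilinField (n := n) M}
    {L : EndField (n := n) M} {eig : M → ℝ} {p : M} (hg : IsMetric g) (hL : IsCompatible g L)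
    (hJ : ∀ᶠ q in 𝓝 p, IsSingleJordanBlock n (L q) (eig q)) :
    ∃ φ ∈ IsManifold.maximalAtlas (𝓡 n) ∞ M, p ∈ φ.source ∧
      ∃ (ε : ℝ) (lam : ℝ → ℝ), (ε = 1 ∨ ε = -1) ∧ ContDiff ℝ ∞ lam ∧
        (∀ q ∈ φ.source, eig q = lam (coord (φ q) n)) ∧
        ∀ y ∈ φ.target, bilinComponents φ g y = ε • gNormal lam y ∧
          endComponents φ L y = lNormal lam y := by
  have hM1 : IsManifold (𝓡 n) 1 M := IsManifold.of_le (n := ∞) (by simp)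
  set φ₀ := chartAt (E n) p with hφ₀
  have hatlas : φ₀ ∈ atlas (E n) M := chart_mem_atlas _ p
  have hφd : φ₀.MDifferentiable (𝓡 n) (𝓡 n) := mdifferentiable_of_mem_atlas hatlas
  have hpφ : p ∈ φ₀.source := mem_chart_source _ p
  obtain ⟨O, hO, hOo, hpO⟩ := eventually_nhds_iff.mp hJ
  set U : Set (E n) := φ₀.target ∩ φ₀.symm ⁻¹' O with hUdef
  have hU : IsOpen U := φ₀.isOpen_inter_preimage_symm hOo
  have hUt : U ⊆ φ₀.target := Set.inter_subset_left
  have hpU : φ₀ p ∈ U := ⟨φ₀.map_source hpφ, by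
    rw [Set.mem_preimage, φ₀.left_inv hpφ]
    exact hpO⟩
  set A := endComponents φ₀ L with hA
  have hn0 : (n : ℝ) ≠ 0 := Nat.cast_ne_zero.mpr hn.ne'
  -- No regularity of `eig` is assumed; smoothness comes from writing the eigenvalue as `tr L / n`.
  set lam : E n → ℝ := fun y => (A y).trace / n with hlamdef
  have hAc := hL φ₀ hatlas
  have hlam : ContDiffOn ℝ ∞ lam U :=
    (ContDiffOn.sum fun i _ => (hAc.smooth i i).mono hUt).div_const _
  have heig : ∀ y ∈ U, lam y = eig (φ₀.symm y) := fun y hy => by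
    obtain ⟨b, hb⟩ := exists_basis_coordVec hφd hy.1 L
    have := (hO _ hy.2).trace_toMatrix b
    rw [hb] at this
    simp only [hlamdef, hA]
    rw [this, mul_div_cancel_left₀ _ hn0]
  have hpow : ∀ y ∈ U, ∀ k, (A y - lam y • 1) ^ k = 0 ↔ jordanBlock n 0 ^ k = 0 :=
    fun y hy k => by
      obtain ⟨b, hb⟩ := exists_basis_coordVec hφd hy.1 L
      have := (hO _ hy.2).toMatrix_pow_eq_zero_iff b k
      rwa [hb, ← heig y hy] at this
  obtain ⟨ψ, ε, F, hpψ, hψU, hψ, hψs, hε, hF, hval, hform⟩ :=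
    exists_normal_form_coordinates hn hU ((hg φ₀ hatlas).mono hUt) (hAc.mono hUt) hlam
      (fun y hy => (hpow y hy n).mpr jordanBlock_zero_pow_self) hpU
      fun h => jordanBlock_zero_pow_pred_ne_zero hn ((hpow _ hpU _).mp h)
  refine ⟨φ₀.trans ψ, trans_mem_maximalAtlas (IsManifold.subset_maximalAtlas hatlas) hψ hψs, ?_,
    ε, F, hε, hF, fun q hq => ?_, fun y hy => ?_⟩
  · rw [OpenPartialHomeomorph.trans_source]
    exact ⟨hpφ, hpψ⟩
  · rw [OpenPartialHomeomorph.trans_source] at hq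
    have h1 := heig (φ₀ q) (hψU hq.2)
    rw [φ₀.left_inv hq.1] at h1
    rw [← h1, hval _ hq.2]
    rfl
  · rw [bilinComponents_trans hφd hψs hy, endComponents_trans hφd hψ hψs hy]
    exact hform y hy.1

end LocalNormalForm

end JordanNormalForm

end

theorem theorem1p4 (n : ℕ) (hn : 1 ≤ n) :
    -- normal form of a compatible pair near a point
    (∀ (M : Type*) [TopologicalSpace M] [ChartedSpace (JordanNormalForm.E n) M]
        [IsManifold (𝓡 n) ∞ M]
        (g : JordanNormalForm.BilinField (n := n) M) (L : JordanNormalForm.EndField (n := n) M)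
        (eig : M → ℝ) (p : M),
        JordanNormalForm.IsMetric g →
        JordanNormalForm.IsCompatible g L →
        (∀ᶠ q in 𝓝 p, JordanNormalForm.IsSingleJordanBlock n (L q) (eig q)) →
        ∃ φ ∈ IsManifold.maximalAtlas (𝓡 n) ∞ M, p ∈ φ.source ∧
          ∃ (ε : ℝ) (lam : ℝ → ℝ), (ε = 1 ∨ ε = -1) ∧ ContDiff ℝ ∞ lam ∧
            (∀ q ∈ φ.source, eig q = lam (JordanNormalForm.coord (φ q) n)) ∧
            ∀ y ∈ φ.target,
              JordanNormalForm.bilinComponents φ g y = ε • JordanNormalForm.gNormal lam y ∧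
              JordanNormalForm.endComponents φ L y = JordanNormalForm.lNormal lam y) ∧
    -- conversely, the normal forms are compatible where the metric is nondegenerate
    (∀ (I : Set ℝ) (lam : ℝ → ℝ) (ε : ℝ), IsOpen I → ContDiffOn ℝ ∞ lam I →
        (∀ t ∈ I, lam t ≠ 0) → (ε = 1 ∨ ε = -1) →
        (∀ x : JordanNormalForm.E n, JordanNormalForm.coord x n ∈ I →
          ((JordanNormalForm.gNormal lam x).det ≠ 0 ↔
            1 + ((n : ℝ) - 1) * deriv lam (JordanNormalForm.coord x n) *
              JordanNormalForm.coord x (n - 1) ≠ 0)) ∧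
        JordanNormalForm.IsMetricOn
          {x : JordanNormalForm.E n | JordanNormalForm.coord x n ∈ I ∧
            (JordanNormalForm.gNormal lam x).det ≠ 0}
          (fun x => ε • JordanNormalForm.gNormal lam x) ∧
        JordanNormalForm.IsCompatibleOn
          {x : JordanNormalForm.E n | JordanNormalForm.coord x n ∈ I ∧
            (JordanNormalForm.gNormal lam x).det ≠ 0}
          (fun x => ε • JordanNormalForm.gNormal lam x)
          (fun x => JordanNormalForm.lNormal lam x)) := by
  refine ⟨fun M _ _ _ g L eig p hg hL hJ => ?_, fun I lam ε hI hlam hne hε => ⟨fun x _ => ?_, ?_⟩⟩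
  · exact JordanNormalForm.exists_chart_normal_form hn hg hL hJ
  · rw [JordanNormalForm.gNormal_det hn, JordanNormalForm.normalCoframe_det hn]
  · exact JordanNormalForm.normalForm_compatible hn hI hlam hne (by
      rcases hε with h | h <;> simp [h])
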